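/- **Setting.** A radio network is a finite directed graph on $n$ nodes (undirected networks are the special case of symmetric edges), where an edge $(u,v)$ means that transmissions of $u$ reach $v$; one node $s$ is the source and holds a message $m$, a finite bit string. Time proceeds in synchronous steps. In each step every node either transmits a finite bit string of its choice or listens. A listening node receives a transmitted string if and only if exactly one of its in-neighbors transmits; with collision detection, it can moreover distinguish the case that no in-neighbor transmits (silence) from the case that at least two do (collision). The network is blind: all nodes run the same randomized protocol, with independent private randomness and a global clock, and have no identifiers and no prior knowledge of the network, of $n$, or of any distance; a node knows only whether it is the source (and then $m$), its private randomness, and its own observations so far. A node other than the source that has heard nothing but silence so far does not transmit. Broadcasting is completed within time $\tau$ if from time $\tau$ on every node outputs $m$. Write $\log x$ for $\max\{\log_2 x,1\}$. **Theorem.** In blind directed radio networks with collision detection, randomized broadcasting can be performed in $O\left(D\log\frac nD\,\log\log\log\frac nD+\log^2 n\right)$ time with high probability, where $D$ is the eccentricity of the source. Precisely: there are a single such protocol and constants $K,c>0$ and $n_0$ such that, for every $n\ge n_0$, every directed graph on $n$ nodes, every source $s$, every message $m$, and every integer $D$ such that all nodes are at directed distance at most $D$ from $s$ (for instance $D=\max_v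 \mathrm{dist}(s,v)$, or the diameter of the network if it is finite), with probability at least $1-n^{-c}$ broadcasting is completed within time $$K\left(D\log\frac nD\,\log\log\log\frac nD+\log^2 n\right).$$ -/

import Mathlib

open MeasureTheory

namespace RadioNetwork

/-- Source messages and transmitted packets are finite bit strings (of unbounded length). -/
abbrev BitString := List Bool

/-- What a node experiences in one time-step, in the model with collision detection.
`sending`: it transmitted, hence did not listen. Otherwise it listened, and none (`silence`),
exactly one (`received p`, with `p` the packet sent), or at least two (`collision`) of its
in-neighbors transmitted. -/
inductive Obs where
  | sending
  | silence
  | received (p : BitString)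
  | collision

/-- A blind randomized radio protocol. All nodes run the same code; they have no identifiers and
no information about the network (its topology, its size `n`, or any distance in it).

The local state of a node consists of
* its role: `some m` for the source, which holds the source message `m`, and `none` for all others;
* its private randomness, one sample of the probability space `(Coin, coinLaw)`;
* the list of its observations in all past time-steps, most recent first. The length of this list
  is the number of elapsed time-steps, so nodes have access to a global clock.

Actions take countably many values for each of countably many local histories, so nothing is
gained or lost compared with an infinite private tape of fair coin flips. -/
structure BlindProtocol where
  /-- the sample space of the private randomness of one node -/
  Coin : Type
  [measurableSpaceCoin : MeasurableSpace Coin]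
  /-- the law of the private randomness of one node -/
  coinLaw : Measure Coin
  [isProbabilityMeasure_coinLaw : IsProbabilityMeasure coinLaw]
  /-- the action in the next time-step: `some p` is `transmit p`, and `none` is `listen` -/
  act : (role : Option BitString) → Coin → List Obs → Option BitString
  /-- the message which the node currently believes to be the source message, if any -/
  output : (role : Option BitString) → List Obs → Option BitString
  measurableSet_act : ∀ role h a, MeasurableSet {r | act role r h = a}
  /-- A node other than the source that has heard nothing but silence so far stays inactive. -/
  inactive : ∀ r h, (∀ o ∈ h, o = Obs.silence) → act none r h = none

attribute [instance] BlindProtocol.measurableSpaceCoin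
  BlindProtocol.isProbabilityMeasure_coinLaw

section Execution

variable {V : Type*}

open Classical in
/-- The observation of `v` in a time-step in which the nodes perform the actions `a`.
An edge from `u` to `v` means that transmissions of `u` reach `v`. -/
noncomputable def observe (G : Digraph V) (a : V → Option BitString) (v : V) : Obs :=
  if a v ≠ none then Obs.sending
  else if h : ∃! u, G.Adj u v ∧ a u ≠ none then
    Obs.received ((a h.choose).get (Option.isSome_iff_ne_none.mpr h.choose_spec.1.2))
  else if ∃ u, G.Adj u v ∧ a u ≠ none then Obs.collision
  else Obs.silence

open Classical in
/-- Only the source `s` initially holds the source message `m`. -/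
noncomputable def role (s : V) (m : BitString) (v : V) : Option BitString :=
  if v = s then some m else none

/-- The local history of every node after `t` time-steps, when node `v` has randomness `ω v`. -/
noncomputable def history (A : BlindProtocol) (G : Digraph V) (s : V) (m : BitString)
    (ω : V → A.Coin) : ℕ → V → List Obs
  | 0, _ => []
  | t + 1, v =>
      observe G (fun u => A.act (role s m u) (ω u) (history A G s m ω t u)) v
        :: history A G s m ω t v

/-- After `t` time-steps, node `v` knows the source message. -/
def Informed (A : BlindProtocol) (G : Digraph V) (s : V) (m : BitString)
    (ω : V → A.Coin) (t : ℕ) (v : V) : Prop :=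
  A.output (role s m v) (history A G s m ω t v) = some m

/-- Broadcasting is completed within time `τ`: from then on, all nodes know the source message. -/
def CompletedWithin (A : BlindProtocol) (G : Digraph V) (s : V) (m : BitString)
    (ω : V → A.Coin) (τ : ℝ) : Prop :=
  ∀ t : ℕ, τ ≤ t → ∀ v, Informed A G s m ω t v

/-- The nodes draw their private randomness independently. -/
noncomputable def randomness (A : BlindProtocol) (V : Type*) [Fintype V] :
    Measure (V → A.Coin) :=
  Measure.pi fun _ => A.coinLaw

end Execution

section Distance

variable {V : Type*}

/-- There is a directed walk with exactly `k` edges from `u` to `v`. -/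
def WalkOfLength (G : Digraph V) : ℕ → V → V → Prop
  | 0, u, v => u = v
  | k + 1, u, v => ∃ w, WalkOfLength G k u w ∧ G.Adj w v

/-- The directed hop distance from `u` to `v` (`⊤` if `v` is not reachable from `u`). -/
noncomputable def dist (G : Digraph V) (u v : V) : ℕ∞ :=
  ⨅ (k : ℕ) (_ : WalkOfLength G k u v), (k : ℕ∞)

/-- The largest distance from `s` to a node of the network. -/
noncomputable def eccentricity (G : Digraph V) (s : V) : ℕ∞ :=
  ⨆ v, dist G s v

end Distance

/-- The convention `log x = max {log₂ x, 1}`. -/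
noncomputable def lg (x : ℝ) : ℝ := max (Real.logb 2 x) 1

/-- `D log (n/D) log log log (n/D) + log² n`. -/
noncomputable def timeBound (n D : ℕ) : ℝ :=
  D * lg (n / D) * lg (lg (lg (n / D))) + lg n ^ 2

end RadioNetwork

/-! The argument yields the bound `O(D log(n/D) + log² n)`, without the triple logarithm;
`le_timeBound` then discards the difference. Since neither `n` nor `D` is known, the source restarts
the broadcast in phases whose lengths `3 * 4 ^ b` grow geometrically, and it suffices to analyse the
first phase with `T = 4 ^ b` at least `10 ^ 20 * (D * lg (n / D) + lg n ^ 2)`. Collision detection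
serves only for the initial beep wave, which tells every node its distance `d` (`beep_wave`).

In a phase, informed nodes share a public seed `z` for each step. With `α = z / T`, a node at
distance `d` transmits with probability `exp(-rate * α²) / 2`, where `rate = T / (d + √T)`. Without
knowledge of `D`, the distance `d` takes its place. Suppose that a node has between 1 and `N`
informed in-neighbours, all at distances between `d` and `D`, and put `k = log N + 3`. As `α` grows,
the expected number of transmitters falls from at least `1/2` to `0`. Around the crossing of `1/2`
it stays of constant order on a window of length about `1 / g`, where `g = √(rate(d) * k)`, and the
window starts at some `α` with `α² ≤ k / rate(D)`. The seed has tail `1 / (1 + α)`, so it hits the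
window with probability of order at least `1 / (g * (1 + k / rate(D)))`; this gives
`measure_success_ge`.

For a target `v`, fix a shortest path to it. Every node is charged to the last path vertex that it
can inform directly, so the numbers `N j` of possible competitors at the hops `j` sum to at most
`n`. A multiplicative drift argument (`lintegral_potential_le`, `measure_notMem_phaseSet_le`) turns
the waiting times of the hops into an exponential tail bound for the time at which `v` is informed.

It remains to sum the waiting times (`sum_waitingTime_le`). Relative to `l = lg (n / D)`, hop `j`
costs about `√(T * l / D) * √(D / j)` times a polylogarithmic function of `1 + N j * D / n`. Both
factors average to constants over the hops, so the sum is `O(√(T * D * l))`, a small fraction of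
`T`. Choosing `β = log n / T` makes each node fail with probability at most `n⁻²`, and a union bound
finishes. -/

namespace RadioNetwork

/-! ### Multiplicative drift for processes driven by independent randomness -/

section Drift

open ProbabilityTheory ENNReal

variable {ι Ω₀ α : Type*} [Fintype ι] [MeasurableSpace Ω₀] [MeasurableSpace α]

/-- A process driven by fresh coordinates of a doubly indexed product space is independent of
the coordinates that it has not used yet. -/
lemma indepFun_of_driven [Countable α] [MeasurableSingletonClass α]
    (ν : Measure Ω₀) [IsProbabilityMeasure ν] (F : α → (ι → Ω₀) → α)
    (hF : ∀ x, Measurable (F x)) (x₀ : α) (t₀ : ℕ) (X : ℕ → (ι → ℕ → Ω₀) → α)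
    (hX₀ : ∀ ω, X 0 ω = x₀) (hX : ∀ t ω, X (t + 1) ω = F (X t ω) (fun u => ω u (t₀ + t)))
    (t : ℕ) :
    Measurable (X t) ∧ IndepFun (X t) (fun ω u => ω u (t₀ + t))
      (Measure.pi fun _ : ι => Measure.infinitePi fun _ : ℕ => ν) := by
  set P := (Measure.pi fun _ : ι => Measure.infinitePi fun _ : ℕ => ν) with hP
  let m : ι × ℕ → MeasurableSpace (ι → ℕ → Ω₀) :=
    fun p => MeasurableSpace.comap (fun ω => ω p.1 p.2) inferInstance
  have hm : ∀ p, m p ≤ MeasurableSpace.pi := fun p =>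
    Measurable.comap_le (by fun_prop)
  have hind : iIndep m P := by
    have h := iIndepFun_uncurry_infinitePi' (ι := ι) (κ := ℕ) (Ω := fun _ _ => Ω₀)
      (X := fun _ _ x => x) (fun _ _ => ν) (fun _ _ => measurable_id)
    rw [Measure.infinitePi_eq_pi] at h
    exact h
  have hF2 : Measurable (fun p : α × (ι → Ω₀) => F p.1 p.2) :=
    measurable_from_prod_countable_right hF
  -- By induction, `X t` depends only on the coordinates with time index below `t₀ + t`.
  have hmX : ∀ t, Measurable[⨆ p ∈ {p : ι × ℕ | p.2 < t₀ + t}, m p] (X t) := by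
    intro t
    induction t with
    | zero =>
      rw [show X 0 = fun _ => x₀ from funext hX₀]
      exact measurable_const
    | succ t ih =>
      rw [show X (t + 1) = fun ω => F (X t ω) (fun u => ω u (t₀ + t)) from funext (hX t)]
      have h1 : Measurable[⨆ p ∈ {p : ι × ℕ | p.2 < t₀ + (t + 1)}, m p] (X t) := by
        refine ih.mono ?_ le_rfl
        exact biSup_mono fun p (hp : p.2 < t₀ + t) => (by omega : p.2 < t₀ + (t + 1))
      have h2 : Measurable[⨆ p ∈ {p : ι × ℕ | p.2 < t₀ + (t + 1)}, m p]
          (fun (ω : ι → ℕ → Ω₀) u => ω u (t₀ + t)) := by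
        refine @measurable_pi_lambda _ _ _ (_) _ _ fun u => ?_
        have h3 : Measurable[m (u, t₀ + t)] (fun ω : ι → ℕ → Ω₀ => ω u (t₀ + t)) :=
          comap_measurable _
        exact h3.mono (le_iSup₂_of_le (u, t₀ + t) (by omega : t₀ + t < t₀ + (t + 1)) le_rfl) le_rfl
      exact hF2.comp (h1.prodMk h2)
  refine ⟨(hmX t).mono (iSup₂_le fun p _ => hm p) le_rfl, ?_⟩
  have hI := indep_iSup_of_disjoint hm hind (S := {p : ι × ℕ | p.2 < t₀ + t})
    (T := {p : ι × ℕ | p.2 = t₀ + t}) (by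
      exact Set.disjoint_left.2 fun p (hp : p.2 < t₀ + t) (hq : p.2 = t₀ + t) => by omega)
  have h2 : Measurable[⨆ p ∈ {p : ι × ℕ | p.2 = t₀ + t}, m p]
      (fun (ω : ι → ℕ → Ω₀) u => ω u (t₀ + t)) := by
    refine @measurable_pi_lambda _ _ _ (_) _ _ fun u => ?_
    have h3 : Measurable[m (u, t₀ + t)] (fun ω : ι → ℕ → Ω₀ => ω u (t₀ + t)) :=
      comap_measurable _
    exact h3.mono (le_iSup₂_of_le (u, t₀ + t) rfl le_rfl) le_rfl
  rw [IndepFun_iff_Indep]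
  exact indep_of_indep_of_le_right (indep_of_indep_of_le_left hI (hmX t).comap_le) h2.comap_le

lemma map_eval_driven (ν : Measure Ω₀) [IsProbabilityMeasure ν] (t : ℕ) :
    (Measure.pi fun _ : ι => Measure.infinitePi fun _ : ℕ => ν).map (fun ω u => ω u t) =
      Measure.pi fun _ : ι => ν := by
  have h := Measure.infinitePi_map_pi (μ := fun _ : ι => Measure.infinitePi fun _ : ℕ => ν)
    (f := fun _ ω => ω t) (fun _ => measurable_pi_apply t)
  rw [Measure.infinitePi_eq_pi] at h
  simp_rw [Measure.infinitePi_map_eval] at h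
  rw [h, Measure.infinitePi_eq_pi]

/-- Multiplicative drift: if in expectation a potential shrinks by the factor `ρ` in each step,
then it shrinks by `ρ ^ t` in `t` steps. -/
lemma lintegral_potential_le [Countable α] [MeasurableSingletonClass α]
    (ν : Measure Ω₀) [IsProbabilityMeasure ν] (F : α → (ι → Ω₀) → α)
    (hF : ∀ x, Measurable (F x)) (x₀ : α) (t₀ : ℕ) (X : ℕ → (ι → ℕ → Ω₀) → α)
    (hX₀ : ∀ ω, X 0 ω = x₀) (hX : ∀ t ω, X (t + 1) ω = F (X t ω) (fun u => ω u (t₀ + t)))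
    (Inv : α → Prop) (hInv : ∀ t ω, Inv (X t ω)) (W : α → ℝ≥0∞) (ρ : ℝ≥0∞)
    (hW : ∀ x, Inv x → ∫⁻ e, W (F x e) ∂(Measure.pi fun _ : ι => ν) ≤ ρ * W x) (t : ℕ) :
    ∫⁻ ω, W (X t ω) ∂(Measure.pi fun _ : ι => Measure.infinitePi fun _ : ℕ => ν)
      ≤ ρ ^ t * W x₀ := by
  set P := (Measure.pi fun _ : ι => Measure.infinitePi fun _ : ℕ => ν) with hP
  have hWm : Measurable W := measurable_of_countable W
  have hF2 : Measurable (fun p : α × (ι → Ω₀) => F p.1 p.2) :=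
    measurable_from_prod_countable_right hF
  induction t with
  | zero => simp [hX₀]
  | succ t ih =>
    obtain ⟨hmX, hind⟩ := indepFun_of_driven ν F hF x₀ t₀ X hX₀ hX t
    have hξ : Measurable (fun (ω : ι → ℕ → Ω₀) u => ω u (t₀ + t)) := by fun_prop
    rw [indepFun_iff_map_prod_eq_prod_map_map hmX.aemeasurable hξ.aemeasurable,
      map_eval_driven] at hind
    calc ∫⁻ ω, W (X (t + 1) ω) ∂P
        = ∫⁻ ω, W (F (X t ω) (fun u => ω u (t₀ + t))) ∂P := by simp_rw [hX]
      _ = ∫⁻ p, W (F p.1 p.2) ∂(P.map fun ω => (X t ω, fun u => ω u (t₀ + t))) := by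
          exact (lintegral_map (hWm.comp hF2) (hmX.prodMk hξ)).symm
      _ = ∫⁻ x, ∫⁻ e, W (F x e) ∂(Measure.pi fun _ : ι => ν) ∂(P.map (X t)) := by
          rw [hind]; exact lintegral_prod _ (hWm.comp hF2).aemeasurable
      _ ≤ ∫⁻ x, ρ * W x ∂(P.map (X t)) := by
          refine lintegral_mono_ae ?_
          rw [ae_map_iff hmX.aemeasurable (Set.to_countable _).measurableSet]
          exact Filter.Eventually.of_forall fun ω => hW _ (hInv t ω)
      _ = ρ * ∫⁻ ω, W (X t ω) ∂P := by
          rw [lintegral_const_mul _ hWm, lintegral_map hWm hmX]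
      _ ≤ ρ * (ρ ^ t * W x₀) := by gcongr
      _ = ρ ^ (t + 1) * W x₀ := by ring

end Drift

/-! ### Hop distances -/

section HopDistance

variable {V : Type*}

/-- `δ` is the directed hop distance from `s`, and all distances are finite. -/
structure IsHopDistance (G : Digraph V) (s : V) (δ : V → ℕ) : Prop where
  eq_source : ∀ v, δ v = 0 ↔ v = s
  le_succ : ∀ u v, G.Adj u v → δ v ≤ δ u + 1
  exists_parent : ∀ v, v ≠ s → ∃ u, G.Adj u v ∧ δ v = δ u + 1

lemma exists_isHopDistance (G : Digraph V) (s : V) (D : ℕ) (h : eccentricity G s ≤ D) :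
    ∃ δ : V → ℕ, IsHopDistance G s δ ∧ ∀ v, δ v ≤ D := by
  classical
  have hex : ∀ v, ∃ k ≤ D, WalkOfLength G k s v := by
    intro v
    by_contra! hcon
    have h1 : dist G s v ≤ D := (le_iSup (fun v => dist G s v) v).trans h
    have h2 : ((D + 1 : ℕ) : ℕ∞) ≤ dist G s v := by
      refine le_iInf₂ fun k hk => ?_
      have : D < k := by
        by_contra hle
        exact hcon k (by omega) hk
      exact_mod_cast this
    have h3 := h2.trans h1
    norm_cast at h3
    omega
  have hex' : ∀ v, ∃ k, WalkOfLength G k s v := fun v => (hex v).imp fun k hk => hk.2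
  refine ⟨fun v => Nat.find (hex' v), ⟨fun v => ?_, fun u v huv => ?_, fun v hv => ?_⟩, fun v => ?_⟩
  · rw [Nat.find_eq_zero]
    exact eq_comm
  · exact Nat.find_min' _ ⟨u, Nat.find_spec (hex' u), huv⟩
  · have hspec := Nat.find_spec (hex' v)
    rcases hk : Nat.find (hex' v) with _ | k
    · rw [hk] at hspec
      exact absurd hspec.symm hv
    · rw [hk] at hspec
      obtain ⟨u, hu, huv⟩ := hspec
      refine ⟨u, huv, le_antisymm ?_ ?_⟩
      · rw [← hk]
        exact Nat.find_min' _ ⟨u, Nat.find_spec (hex' u), huv⟩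
      · have := Nat.find_min' (hex' u) hu
        omega
  · obtain ⟨k, hk, hw⟩ := hex v
    exact (Nat.find_min' _ hw).trans hk

end HopDistance

/-! ### The protocol -/

/-- The randomness of one node for one time-step: a number for its own decision to transmit, and a
number from which the source derives public randomness. -/
abbrev Sample := unitInterval × unitInterval

/-- The rate at which nodes at distance `d` from the source back off in phase `b`. -/
noncomputable def rate (b d : ℕ) : ℝ := 4 ^ b / (d + 2 ^ b)

/-- The probability with which informed nodes at distance `d` transmit in a time-step of phase `b`
with public seed `z`. -/
noncomputable def transmitProb (b d z : ℕ) : ℝ :=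
  Real.exp (-(rate b d * ((z : ℝ) / 4 ^ b) ^ 2)) / 2

/-- A heavy-tailed public seed, obtained from a uniform random number. -/
noncomputable def seed (b : ℕ) (y : unitInterval) : ℕ := ⌊(4 : ℝ) ^ b * (1 / (y : ℝ) - 1)⌋₊

/-- The packet with contents `(b, m, z)`. No such packet is empty. -/
def encodePacket (b : ℕ) (m : BitString) (z : List ℕ) : BitString :=
  List.replicate (Encodable.encode (b, m, z) + 1) true

lemma encodePacket_ne_nil (b : ℕ) (m : BitString) (z : List ℕ) : encodePacket b m z ≠ [] := by
  simp [encodePacket]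

lemma encodePacket_inj {b b' : ℕ} {m m' : BitString} {z z' : List ℕ}
    (h : encodePacket b m z = encodePacket b' m' z') : b = b' ∧ m = m' ∧ z = z' := by
  have h1 := congrArg List.length h
  simp only [encodePacket, List.length_replicate, Nat.add_right_cancel_iff] at h1
  simpa using Encodable.encode_injective h1

/-- The packet of the source for phase `b` carries the message and the public seeds of the phase. -/
noncomputable def phasePacket (b : ℕ) (m : BitString) (r : ℕ → Sample) : BitString :=
  encodePacket b m (List.ofFn fun i : Fin (3 * 4 ^ b) => seed b (r (4 ^ b + i)).2)

def Obs.isSilence : Obs → Bool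
  | .silence => true
  | _ => false

/-- The first time-step in which something other than silence was observed. -/
def firstHeard (h : List Obs) : ℕ := h.reverse.findIdx fun o => !o.isSilence

open Classical in
/-- Transmit the packet `p` with probability `transmitProb b d z`. -/
noncomputable def randomAction (b d z : ℕ) (x : Sample) (p : BitString) : Option BitString :=
  if (x.1 : ℝ) < transmitProb b d z then some p else none

open Classical in
/-- The empty packet travels as a beep wave by which the nodes learn their distances. In phase `b`,
consisting of the time-steps `t` with `4 ^ b ≤ t < 4 ^ (b + 1)`, the source broadcasts its packet
for that phase anew. -/
noncomputable def action :
    (role : Option BitString) → (ℕ → Sample) → List Obs → Option BitString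
  | some m, r, h =>
      if h.length = 0 then some []
      else randomAction (Nat.log 4 h.length) 0 (seed (Nat.log 4 h.length) (r h.length).2)
        (r h.length) (phasePacket (Nat.log 4 h.length) m r)
  | none, r, h =>
      if ∀ o ∈ h, o = Obs.silence then none
      else if firstHeard h + 1 = h.length then some []
      else if hq : ∃ q : BitString × List ℕ,
          Obs.received (encodePacket (Nat.log 4 h.length) q.1 q.2) ∈ h then
        randomAction (Nat.log 4 h.length) (firstHeard h + 1)
          (hq.choose.2.getD (h.length - 4 ^ Nat.log 4 h.length) 0) (r h.length)
          (encodePacket (Nat.log 4 h.length) hq.choose.1 hq.choose.2)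
      else none

open Classical in
/-- A node outputs the message of any packet that it has received. -/
noncomputable def decodedMessage : (role : Option BitString) → List Obs → Option BitString
  | some m, _ => some m
  | none, h =>
      if hq : ∃ q : ℕ × BitString × List ℕ, Obs.received (encodePacket q.1 q.2.1 q.2.2) ∈ h then
        some hq.choose.2.1
      else none

lemma measurable_seed (b : ℕ) : Measurable (seed b) := by
  unfold seed
  fun_prop

lemma measurableSet_transmit (b d z : ℕ) :
    MeasurableSet {x : Sample | (x.1 : ℝ) < transmitProb b d z} :=
  measurableSet_lt (by fun_prop) measurable_const

lemma measurableSet_randomAction (b d z t : ℕ) (p : BitString) (a : Option BitString) :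
    MeasurableSet {r : ℕ → Sample | randomAction b d z (r t) p = a} := by
  have h : Measurable fun r : ℕ → Sample => (r t) := measurable_pi_apply t
  have h1 := h (measurableSet_transmit b d z)
  by_cases h2 : some p = a <;> by_cases h3 : none = a
  · exact absurd (h2.trans h3.symm) (by simp)
  · convert h1 using 1
    ext r
    simp only [randomAction, Set.mem_preimage, Set.mem_ofPred_eq]
    split_ifs with h4 <;> simp_all
  · convert h1.compl using 1
    ext r
    simp only [randomAction, Set.mem_compl_iff, Set.mem_preimage, Set.mem_ofPred_eq]
    split_ifs with h4 <;> simp_all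
  · convert MeasurableSet.empty using 1
    ext r
    simp only [randomAction, Set.mem_ofPred_eq, Set.mem_empty_iff_false]
    split_ifs with h4 <;> simp_all

lemma measurableSet_action (role : Option BitString) (h : List Obs) (a : Option BitString) :
    MeasurableSet {r | action role r h = a} := by
  rcases role with _ | m
  · simp only [action]
    split_ifs with h1 h2 h3
    · exact MeasurableSet.const _
    · exact MeasurableSet.const _
    · exact measurableSet_randomAction ..
    · exact MeasurableSet.const _
  · simp only [action]
    split_ifs with h1
    · exact MeasurableSet.const _
    set b := Nat.log 4 h.length
    set t := h.length
    have hz : Measurable fun r : ℕ → Sample =>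
        (seed b (r t).2, fun i : Fin (3 * 4 ^ b) => seed b (r (4 ^ b + i)).2) := by
      refine Measurable.prodMk ?_ (measurable_pi_lambda _ fun i => ?_) <;>
      exact (measurable_seed b).comp (by fun_prop)
    -- The packet and the transmission probability depend on the continuous randomness only through
    -- finitely many natural-number seeds; splitting over their countably many values leaves events
    -- with fixed parameters.
    have hS : {r : ℕ → Sample |
        randomAction b 0 (seed b (r t).2) (r t) (phasePacket b m r) = a} =
        ⋃ y : ℕ × (Fin (3 * 4 ^ b) → ℕ),
          {r | (seed b (r t).2, fun i : Fin (3 * 4 ^ b) => seed b (r (4 ^ b + i)).2) = y} ∩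
          {r | randomAction b 0 y.1 (r t) (encodePacket b m (List.ofFn y.2)) = a} := by
      ext r
      simp only [Set.mem_iUnion, Set.mem_inter_iff]
      constructor
      · intro hr
        exact ⟨_, rfl, hr⟩
      · rintro ⟨y, rfl, hr⟩
        exact hr
    rw [hS]
    exact MeasurableSet.iUnion fun y => (hz (measurableSet_singleton y)).inter
      (measurableSet_randomAction ..)

/-- Broadcasting by distance-dependent back-off with public randomness. -/
noncomputable def backoffProtocol : BlindProtocol where
  Coin := ℕ → Sample
  coinLaw := Measure.infinitePi fun _ => volume
  act := action
  output := decodedMessage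
  measurableSet_act := fun role h a => measurableSet_action role h a
  inactive := fun r h hs => by rw [action, if_pos hs]

/-! ### Executions: the beep wave and the spread of the packet within a phase -/

section Execution

variable {V : Type*} {G : Digraph V} {s : V} {m : BitString} {ω : V → ℕ → Sample}

lemma observe_eq_received {a : V → Option BitString} {v : V} {p : BitString}
    (h : observe G a v = Obs.received p) : ∃ u, G.Adj u v ∧ a u = some p := by
  unfold observe at h
  split_ifs at h with h1 h2
  refine ⟨h2.choose, h2.choose_spec.1.1, ?_⟩
  rw [← Obs.received.inj h, Option.some_get]

lemma observe_of_existsUnique {a : V → Option BitString} {v : V} {p : BitString} (hv : a v = none)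
    (h : ∃! u, G.Adj u v ∧ a u ≠ none) (hp : ∀ u, a u ≠ none → a u = some p) :
    observe G a v = Obs.received p := by
  unfold observe
  rw [if_neg (by simpa using hv), dif_pos h]
  congr 1
  rw [Option.get_of_eq_some]
  exact hp _ h.choose_spec.1.2

lemma existsUnique_of_observe {a : V → Option BitString} {v : V} {p : BitString}
    (h : observe G a v = Obs.received p) : ∃! u, G.Adj u v ∧ a u ≠ none := by
  unfold observe at h
  split_ifs at h with h1 h2
  exact h2

lemma observe_eq_silence {a : V → Option BitString} {v : V} (hv : a v = none)
    (h : ∀ u, G.Adj u v → a u = none) : observe G a v = Obs.silence := by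
  have h1 : ¬ ∃ u, G.Adj u v ∧ a u ≠ none := by
    rintro ⟨u, hu, hu'⟩
    exact hu' (h u hu)
  unfold observe
  rw [if_neg (by simpa using hv), dif_neg (fun h2 => h1 h2.exists), if_neg h1]

lemma observe_ne_silence {a : V → Option BitString} {u v : V} (hu : G.Adj u v) (ha : a u ≠ none) :
    observe G a v ≠ Obs.silence := by
  have h1 : ∃ u, G.Adj u v ∧ a u ≠ none := ⟨u, hu, ha⟩
  unfold observe
  rw [if_pos h1]
  split_ifs <;> simp

/-- The action of node `u` in time-step `t`. -/
noncomputable def actionAt (G : Digraph V) (s : V) (m : BitString) (ω : V → ℕ → Sample) (t : ℕ)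
    (u : V) : Option BitString :=
  action (role s m u) (ω u) (history backoffProtocol G s m ω t u)

lemma history_succ (t : ℕ) (v : V) : history backoffProtocol G s m ω (t + 1) v =
    observe G (actionAt G s m ω t) v :: history backoffProtocol G s m ω t v := rfl

@[simp] lemma length_history (t : ℕ) (v : V) :
    (history backoffProtocol G s m ω t v).length = t := by
  induction t with
  | zero => rfl
  | succ t ih => rw [history_succ, List.length_cons, ih]

lemma mem_history_of_le {t t' : ℕ} (h : t ≤ t') {v : V} {o : Obs}
    (ho : o ∈ history backoffProtocol G s m ω t v) :
    o ∈ history backoffProtocol G s m ω t' v := by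
  induction t', h using Nat.le_induction with
  | base => exact ho
  | succ t' _ ih => exact List.mem_cons_of_mem _ ih

lemma role_source : role s m s = some m := by simp [role]

lemma role_of_ne {v : V} (h : v ≠ s) : role s m v = none := by simp [role, h]

/-- All packets ever received are empty, or the packet of the source for the phase in which they
were sent. -/
lemma received_eq (t : ℕ) (v : V) (p : BitString)
    (h : Obs.received p ∈ history backoffProtocol G s m ω t v) :
    p = [] ∨ ∃ t' < t, t' ≠ 0 ∧ p = phasePacket (Nat.log 4 t') m (ω s) := by
  induction t generalizing v p with
  | zero => simp [history] at h
  | succ t ih =>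
    rw [history_succ, List.mem_cons] at h
    rcases h with h | h
    · obtain ⟨u, -, hu⟩ := observe_eq_received h.symm
      unfold actionAt at hu
      by_cases hus : u = s
      · subst hus
        rw [role_source, action, length_history] at hu
        split_ifs at hu with h0
        · exact Or.inl (by simpa using hu.symm)
        · unfold randomAction at hu
          split_ifs at hu
          exact Or.inr ⟨t, by omega, h0, by simpa using hu.symm⟩
      · rw [role_of_ne hus, action, length_history] at hu
        split_ifs at hu with h0 h1 h2
        · exact Or.inl (by simpa using hu.symm)
        · unfold randomAction at hu
          split_ifs at hu
          simp only [Option.some.injEq] at hu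
          rcases ih _ _ h2.choose_spec with h3 | ⟨t', ht', h0', h3⟩
          · exact absurd h3 (encodePacket_ne_nil _ _ _)
          · exact Or.inr ⟨t', by omega, h0', hu ▸ h3⟩
    · rcases ih v p h with h1 | ⟨t', ht', h0, h1⟩
      · exact Or.inl h1
      · exact Or.inr ⟨t', by omega, h0, h1⟩

lemma message_of_received {t : ℕ} {v : V} {q : ℕ × BitString × List ℕ}
    (h : Obs.received (encodePacket q.1 q.2.1 q.2.2) ∈ history backoffProtocol G s m ω t v) :
    ∃ t' < t, t' ≠ 0 ∧ q.1 = Nat.log 4 t' ∧ q.2.1 = m ∧ q.2.2 =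
      List.ofFn fun i : Fin (3 * 4 ^ q.1) => seed q.1 (ω s (4 ^ q.1 + i)).2 := by
  rcases received_eq t v _ h with h1 | ⟨t', ht', h0, h1⟩
  · exact absurd h1 (encodePacket_ne_nil _ _ _)
  · obtain ⟨h2, h3, h4⟩ := encodePacket_inj h1
    refine ⟨t', ht', h0, h2, h3, ?_⟩
    rw [h4, h2]

lemma informed_of_received {b t : ℕ} {v : V}
    (h : v = s ∨ Obs.received (phasePacket b m (ω s)) ∈ history backoffProtocol G s m ω t v) :
    Informed backoffProtocol G s m ω t v := by
  change decodedMessage (role s m v) (history backoffProtocol G s m ω t v) = some m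
  by_cases hv : v = s
  · rw [hv, role_source]
    rfl
  · have hq : ∃ q : ℕ × BitString × List ℕ, Obs.received (encodePacket q.1 q.2.1 q.2.2) ∈
        history backoffProtocol G s m ω t v := ⟨(b, m, _), h.resolve_left hv⟩
    rw [role_of_ne hv, decodedMessage, dif_pos hq]
    obtain ⟨t', -, -, -, h2, -⟩ := message_of_received hq.choose_spec
    rw [h2]

variable {δ : V → ℕ}

lemma firstHeard_cons_of_lt {o : Obs} {h : List Obs} (hh : firstHeard h < h.length) :
    firstHeard (o :: h) = firstHeard h := by
  unfold firstHeard at hh ⊢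
  rw [List.reverse_cons, List.findIdx_append, if_pos (by simpa using hh)]

lemma firstHeard_cons_of_silent {o : Obs} {h : List Obs} (hh : ∀ o ∈ h, o = Obs.silence)
    (ho : o ≠ Obs.silence) : firstHeard (o :: h) = h.length := by
  have h1 : h.reverse.findIdx (fun o => !o.isSilence) = h.reverse.length := by
    rw [List.findIdx_eq_length]
    intro x hx
    rw [hh x (by simpa using hx)]
    rfl
  have h2 : o.isSilence = false := by cases o <;> simp_all [Obs.isSilence]
  unfold firstHeard
  rw [List.reverse_cons, List.findIdx_append, h1]
  simp [List.findIdx_cons, h2]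

lemma not_silent_of_firstHeard {h : List Obs} (hh : firstHeard h < h.length) :
    ¬ ∀ o ∈ h, o = Obs.silence := by
  intro hs
  have h1 : h.reverse.findIdx (fun o => !o.isSilence) = h.reverse.length := by
    rw [List.findIdx_eq_length]
    intro x hx
    rw [hs x (by simpa using hx)]
    rfl
  rw [firstHeard, h1, List.length_reverse] at hh
  exact lt_irrefl _ hh

/-- The beep wave reaches the nodes at distance `d` exactly in time-step `d - 1`. -/
lemma beep_wave (hδ : IsHopDistance G s δ) (t : ℕ) (v : V) (hv : v ≠ s) :
    (t < δ v → ∀ o ∈ history backoffProtocol G s m ω t v, o = Obs.silence) ∧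
    (δ v ≤ t → firstHeard (history backoffProtocol G s m ω t v) + 1 = δ v) := by
  have hpos : ∀ v, v ≠ s → 0 < δ v := fun v hv =>
    Nat.pos_of_ne_zero fun h0 => hv ((hδ.eq_source v).1 h0)
  induction t generalizing v with
  | zero =>
    refine ⟨fun _ o ho => by simp [history] at ho, fun h => ?_⟩
    have := hpos v hv
    omega
  | succ t ih =>
    have hquiet : ∀ u, t < δ u → actionAt G s m ω t u = none := by
      intro u hu
      have hus : u ≠ s := by
        rintro rfl
        rw [(hδ.eq_source u).2 rfl] at hu
        omega
      rw [actionAt, role_of_ne hus, action, if_pos ((ih u hus).1 hu)]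
    have hbeep : ∀ u, δ u = t → actionAt G s m ω t u ≠ none := by
      intro u hu
      by_cases hus : u = s
      · subst hus
        have ht : t = 0 := by rw [← hu, hδ.eq_source]
        rw [actionAt, role_source, action, if_pos (by simpa using ht)]
        simp
      · have h1 := (ih u hus).2 hu.le
        rw [actionAt, role_of_ne hus, action,
          if_neg (not_silent_of_firstHeard (by rw [length_history]; omega)),
          if_pos (by rw [length_history, h1, hu])]
        simp
    rw [history_succ]
    refine ⟨fun ht o ho => ?_, fun ht => ?_⟩
    · rcases List.mem_cons.1 ho with rfl | ho
      · refine observe_eq_silence (hquiet v (by omega)) fun u hu => hquiet u ?_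
        have := hδ.le_succ u v hu
        omega
      · exact (ih v hv).1 (by omega) o ho
    · rcases Nat.lt_or_eq_of_le ht with h1 | h1
      · have h2 := (ih v hv).2 (by omega)
        rw [firstHeard_cons_of_lt (by rw [length_history]; omega), h2]
      · obtain ⟨u, hu, huv⟩ := hδ.exists_parent v hv
        rw [firstHeard_cons_of_silent ((ih v hv).1 (by omega))
          (observe_ne_silence hu (hbeep u (by omega))), length_history, h1]

open Classical in
/-- One step of the broadcast of a phase: `x` is the set of nodes that have the packet of the
phase, and `e` is the randomness of the time-step. -/
noncomputable def phaseStep [Fintype V] (G : Digraph V) (s : V) (δ : V → ℕ) (b : ℕ)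
    (x : Finset V) (e : V → Sample) : Finset V :=
  x ∪ Finset.univ.filter fun v =>
    ∃! u, G.Adj u v ∧ u ∈ x ∧ ((e u).1 : ℝ) < transmitProb b (δ u) (seed b (e s).2)

/-- The set of nodes that have the packet of phase `b` after `k` steps of the phase. -/
noncomputable def phaseSet [Fintype V] (G : Digraph V) (s : V) (δ : V → ℕ) (b : ℕ) :
    ℕ → (V → ℕ → Sample) → Finset V
  | 0, _ => {s}
  | k + 1, ω => phaseStep G s δ b (phaseSet G s δ b k ω) fun u => ω u (4 ^ b + k)

lemma source_mem_phaseSet [Fintype V] (b k : ℕ) : s ∈ phaseSet G s δ b k ω := by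
  induction k with
  | zero => simp [phaseSet]
  | succ k ih => simp only [phaseSet, phaseStep, Finset.mem_union, ih, true_or]

-- This removes packets and histories from the analysis. A packet reveals the seeds of future steps,
-- but nodes use only the entry of the current step, so the set of holders evolves by `phaseStep`,
-- driven by fresh randomness. The bound on distances ensures that the beep wave has passed before
-- the phase starts.
open Classical in
lemma mem_phaseSet_iff [Fintype V] (hδ : IsHopDistance G s δ) {b : ℕ} (hb : b ≠ 0)
    (hD : ∀ v, δ v < 4 ^ b) (k : ℕ) (hk : k ≤ 3 * 4 ^ b) (v : V) :
    v ∈ phaseSet G s δ b k ω ↔ v = s ∨ Obs.received (phasePacket b m (ω s)) ∈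
      history backoffProtocol G s m ω (4 ^ b + k) v := by
  induction k generalizing v with
  | zero =>
    simp only [phaseSet, Finset.mem_singleton, Nat.add_zero]
    refine ⟨Or.inl, fun h => h.resolve_right fun h1 => ?_⟩
    -- Before time `4 ^ b` only packets of earlier phases were sent, so initially only the source
    -- holds the packet.
    obtain ⟨t', ht', h0, h2, -⟩ := message_of_received (q := (b, m, _)) h1
    have h3 : b < b := by
      conv_lhs => rw [show b = Nat.log 4 t' from h2]
      exact Nat.log_lt_of_lt_pow h0 ht'
    exact lt_irrefl _ h3
  | succ k ih =>
    set t := 4 ^ b + k with ht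
    have hlog : Nat.log 4 t = b := by
      rw [Nat.log_eq_iff (Or.inl hb), pow_succ]
      omega
    have ht0 : t ≠ 0 := by have := Nat.pow_pos (n := b) (show 0 < 4 by norm_num); omega
    set x := phaseSet G s δ b k ω with hx
    have ih' := fun v => ih (by omega) v
    have hact : ∀ u, actionAt G s m ω t u = if u ∈ x then
        randomAction b (δ u) (seed b (ω s t).2) (ω u t) (phasePacket b m (ω s)) else none := by
      intro u
      by_cases hus : u = s
      · subst hus
        rw [if_pos (source_mem_phaseSet b k), actionAt, role_source, action,
          if_neg (by simpa using ht0), length_history, hlog, (hδ.eq_source u).2 rfl]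
      · have hdu := hD u
        have hfirst := (beep_wave (m := m) (ω := ω) hδ t u hus).2 (by omega)
        rw [actionAt, role_of_ne hus, action,
          if_neg (not_silent_of_firstHeard (by rw [length_history]; omega)),
          if_neg (by rw [length_history, hfirst]; omega), length_history, hlog, hfirst]
        by_cases hux : u ∈ x
        · rw [if_pos hux]
          have hrec := ((ih' u).1 hux).resolve_left hus
          have hq : ∃ q : BitString × List ℕ, Obs.received (encodePacket b q.1 q.2) ∈
              history backoffProtocol G s m ω t u := ⟨(m, _), hrec⟩
          rw [dif_pos hq]
          obtain ⟨_, -, -, -, h2, h3⟩ :=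
            message_of_received (q := (b, hq.choose.1, hq.choose.2)) hq.choose_spec
          simp only at h2 h3
          rw [h2, h3]
          -- The index lies within the list of seeds, so the default value `0` in `action` is never
          -- used, and the entry is the seed that the source uses itself in this step.
          have h4 : t - 4 ^ b < 3 * 4 ^ b := by omega
          have h5 : 4 ^ b + (t - 4 ^ b) = t := by omega
          simp only [List.getD_eq_getElem?_getD, List.getElem?_ofFn, h4, dite_true,
            Option.getD_some, h5]
          rfl
        · rw [if_neg hux, dif_neg]
          rintro ⟨q, hq⟩
          obtain ⟨_, -, -, -, h2, h3⟩ := message_of_received (q := (b, q.1, q.2)) hq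
          simp only at h2 h3
          rw [h2, h3] at hq
          exact hux ((ih' u).2 (Or.inr hq))
    have hne : ∀ u, actionAt G s m ω t u ≠ none ↔
        u ∈ x ∧ ((ω u t).1 : ℝ) < transmitProb b (δ u) (seed b (ω s t).2) := by
      intro u
      rw [hact, randomAction]
      split_ifs <;> simp_all
    have hsome : ∀ u, actionAt G s m ω t u ≠ none →
        actionAt G s m ω t u = some (phasePacket b m (ω s)) := by
      intro u hu
      rw [hact, if_pos ((hne u).1 hu).1, randomAction, if_pos ((hne u).1 hu).2]
    have hmem : v ∈ phaseSet G s δ b (k + 1) ω ↔ v ∈ x ∨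
        ∃! u, G.Adj u v ∧ actionAt G s m ω t u ≠ none := by
      simp only [hne, phaseSet, phaseStep, Finset.mem_union, Finset.mem_filter, Finset.mem_univ,
        true_and]
      rfl
    rw [hmem, ← add_assoc, ← ht, history_succ, List.mem_cons]
    constructor
    · rintro (h | h)
      · exact ((ih' v).1 h).imp_right Or.inr
      -- A holder of the packet may be transmitting and then hears nothing, but it needs nothing
      -- new; other nodes listen.
      · by_cases hvx : v ∈ x
        · exact ((ih' v).1 hvx).imp_right Or.inr
        · refine Or.inr (Or.inl (observe_of_existsUnique ?_ h hsome).symm)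
          rw [hact, if_neg hvx]
    · rintro (h | h | h)
      · exact Or.inl ((ih' v).2 (Or.inl h))
      · exact Or.inr (existsUnique_of_observe h.symm)
      · exact Or.inl ((ih' v).2 (Or.inr h))

lemma completedWithin_of_phaseSet [Fintype V] (hδ : IsHopDistance G s δ) {b : ℕ} (hb : b ≠ 0)
    (hD : ∀ v, δ v < 4 ^ b) (τ : ℝ) (hτ : (4 : ℝ) ^ (b + 1) ≤ τ)
    (h : ∀ v, v ∈ phaseSet G s δ b (3 * 4 ^ b) ω) :
    CompletedWithin backoffProtocol G s m ω τ := by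
  intro t ht v
  have ht' : 4 ^ b + 3 * 4 ^ b ≤ t := by
    have : ((4 ^ (b + 1) : ℕ) : ℝ) ≤ t := by push_cast; linarith
    have h1 := Nat.cast_le.1 this
    rw [pow_succ] at h1
    omega
  exact informed_of_received (((mem_phaseSet_iff hδ hb hD _ le_rfl v).1 (h v)).imp_right
    (mem_history_of_le ht'))

end Execution

/-! ### Probability that exactly one competitor transmits -/

section Success

lemma rate_pos (b d : ℕ) : 0 < rate b d := by unfold rate; positivity

lemma rate_anti {b d d' : ℕ} (h : d ≤ d') : rate b d' ≤ rate b d := by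
  unfold rate
  gcongr

lemma four_pow_eq (b : ℕ) : (4 : ℝ) ^ b = 2 ^ b * 2 ^ b := by
  rw [← mul_pow]; norm_num

lemma rate_le_two_pow (b d : ℕ) : rate b d ≤ 2 ^ b := by
  unfold rate
  rw [div_le_iff₀ (by positivity), four_pow_eq]
  gcongr
  simp

lemma half_le_rate {b d : ℕ} (h : d ≤ 4 ^ b) : 1 / 2 ≤ rate b d := by
  unfold rate
  have h1 : (d : ℝ) ≤ 4 ^ b := by exact_mod_cast h
  have h2 : (2 : ℝ) ^ b ≤ 4 ^ b := by gcongr; norm_num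
  rw [le_div_iff₀ (by positivity)]
  linarith

lemma transmitProb_pos (b d z : ℕ) : 0 < transmitProb b d z := by unfold transmitProb; positivity

lemma transmitProb_le_half (b d z : ℕ) : transmitProb b d z ≤ 1 / 2 := by
  unfold transmitProb
  have h : 0 ≤ rate b d * ((z : ℝ) / 4 ^ b) ^ 2 := by have := rate_pos b d; positivity
  have : Real.exp (-(rate b d * ((z : ℝ) / 4 ^ b) ^ 2)) ≤ 1 := Real.exp_le_one_iff.2 (by linarith)
  linarith

lemma transmitProb_anti {b d z z' : ℕ} (h : z ≤ z') : transmitProb b d z' ≤ transmitProb b d z := by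
  unfold transmitProb
  have := rate_pos b d
  gcongr

/-- The condition on the seed unfolds to `y` lying between `4 ^ b / (4 ^ b + c)` and `4 ^ b / (4 ^ b
+ a)`: the scaled seed has tail `1 / (1 + α)`, so no scale needs to be known in advance. -/
lemma volume_seed_ge (b a c : ℕ) :
    ENNReal.ofReal (4 ^ b / (4 ^ b + a) - 4 ^ b / (4 ^ b + c)) ≤
      volume {y : unitInterval | a ≤ seed b y ∧ seed b y < c} := by
  have hM : (0 : ℝ) < 4 ^ b := by positivity
  have hmem : ∀ a : ℕ, (4 : ℝ) ^ b / (4 ^ b + a) ∈ Set.Icc (0 : ℝ) 1 := fun a =>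
    ⟨by positivity, div_le_one_of_le₀ (by simp) (by positivity)⟩
  have h := unitInterval.volume_Ioc (x := ⟨_, hmem c⟩) (y := ⟨_, hmem a⟩)
  simp only at h
  rw [← h]
  refine measure_mono fun y hy => ?_
  obtain ⟨h1, h2⟩ := hy
  have h1' : (4 : ℝ) ^ b / (4 ^ b + c) < y := h1
  have h2' : (y : ℝ) ≤ 4 ^ b / (4 ^ b + a) := h2
  have hy0 : (0 : ℝ) < y := lt_of_le_of_lt (hmem c).1 h1'
  rw [div_lt_iff₀ (by positivity)] at h1'
  rw [le_div_iff₀ (by positivity)] at h2'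
  have h3 : (a : ℝ) ≤ 4 ^ b * (1 / (y : ℝ) - 1) := by
    rw [mul_sub, mul_one_div, mul_one, le_sub_iff_add_le, le_div_iff₀ hy0]
    linarith
  have h4 : (4 : ℝ) ^ b * (1 / (y : ℝ) - 1) < c := by
    rw [mul_sub, mul_one_div, mul_one, sub_lt_iff_lt_add, div_lt_iff₀ hy0]
    linarith
  refine ⟨Nat.le_floor h3, ?_⟩
  have hc : 0 < c := by
    have : (0 : ℝ) < c := lt_of_le_of_lt ((Nat.cast_nonneg a).trans h3) h4
    exact_mod_cast this
  exact (Nat.floor_lt' hc.ne').2 h4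

lemma volume_coe_lt {p : ℝ} (h0 : 0 ≤ p) (h1 : p ≤ 1) :
    volume {y : unitInterval | (y : ℝ) < p} = ENNReal.ofReal p :=
  unitInterval.volume_Iio ⟨p, h0, h1⟩

lemma volume_le_coe {p : ℝ} (h0 : 0 ≤ p) (h1 : p ≤ 1) :
    volume {y : unitInterval | p ≤ (y : ℝ)} = ENNReal.ofReal (1 - p) :=
  unitInterval.volume_Ici ⟨p, h0, h1⟩

lemma exp_neg_two_mul_le {p : ℝ} (h0 : 0 ≤ p) (h1 : p ≤ 1 / 2) : Real.exp (-(2 * p)) ≤ 1 - p := by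
  rw [Real.exp_neg]
  refine inv_le_of_inv_le₀ (by linarith) ?_
  have h2 : 2 * p + 1 ≤ Real.exp (2 * p) := Real.add_one_le_exp _
  refine le_trans ?_ h2
  refine inv_le_of_inv_le₀ (by linarith) ?_
  rw [inv_le_iff_one_le_mul₀ (by linarith)]
  nlinarith

variable {V : Type*} [Fintype V]

open Classical in
/-- The probability that exactly one member of `U` transmits, bounded from below by the events that
the seed is in an interval, one member's number is small and those of the others are large. -/
lemma measure_existsUnique_ge (s : V) (U : Finset V) (δ : V → ℕ) (b a c : ℕ) :
    ENNReal.ofReal ((4 ^ b / (4 ^ b + a) - 4 ^ b / (4 ^ b + c)) *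
      ((∑ u ∈ U, transmitProb b (δ u) c) * Real.exp (-(2 * ∑ u ∈ U, transmitProb b (δ u) a)))) ≤
    (Measure.pi fun _ : V => (volume : Measure Sample))
      {e | ∃! u, u ∈ U ∧ ((e u).1 : ℝ) < transmitProb b (δ u) (seed b (e s).2)} := by
  rcases le_or_gt c a with hca | hac
  · have : (4 : ℝ) ^ b / (4 ^ b + a) - 4 ^ b / (4 ^ b + c) ≤ 0 := by
      rw [sub_nonpos]
      gcongr
    rw [ENNReal.ofReal_of_nonpos]
    · exact zero_le
    · refine mul_nonpos_of_nonpos_of_nonneg this ?_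
      have := fun u => (transmitProb_pos b (δ u) c).le
      have := Finset.sum_nonneg fun u (_ : u ∈ U) => this u
      positivity
  have hC0 : (0 : ℝ) ≤ 4 ^ b / (4 ^ b + a) - 4 ^ b / (4 ^ b + c) := by
    rw [sub_nonneg]
    have : (a : ℝ) ≤ c := by exact_mod_cast hac.le
    gcongr
  set pa := fun u => transmitProb b (δ u) a with hpa
  set pc := fun u => transmitProb b (δ u) c with hpc
  have hpa0 : ∀ u, 0 < pa u := fun u => transmitProb_pos ..
  have hpc0 : ∀ u, 0 < pc u := fun u => transmitProb_pos ..
  have hpa1 : ∀ u, pa u ≤ 1 / 2 := fun u => transmitProb_le_half ..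
  have hpc1 : ∀ u, pc u ≤ 1 / 2 := fun u => transmitProb_le_half ..
  let C : Set unitInterval := {y | a ≤ seed b y ∧ seed b y < c}
  have hCm : MeasurableSet C :=
    (measurableSet_le measurable_const (measurable_seed b)).inter
      (measurableSet_lt (measurable_seed b) measurable_const)
  -- Transmission probabilities decrease in the seed. For seeds between `a` and `c`, a number below
  -- `pc u` forces `u` to transmit and a number at least `pa v` forces `v` to be silent. These
  -- conditions no longer mention the seed, so each event is a box in the product space.
  let A : V → V → Set unitInterval := fun u v =>
    if v = u then {y | (y : ℝ) < pc u} else if v ∈ U then {y | pa v ≤ (y : ℝ)} else Set.univ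
  let C' : V → Set unitInterval := fun v => if v = s then C else Set.univ
  let B : V → Set (V → Sample) := fun u => Set.pi Set.univ fun v => A u v ×ˢ C' v
  have hAm : ∀ u v, MeasurableSet (A u v) := by
    intro u v
    simp only [A]
    split_ifs
    · exact measurableSet_lt (by fun_prop) measurable_const
    · exact measurableSet_le measurable_const (by fun_prop)
    · exact MeasurableSet.univ
  have hC'm : ∀ v, MeasurableSet (C' v) := by
    intro v
    simp only [C']
    split_ifs
    · exact hCm
    · exact MeasurableSet.univ
  have hBm : ∀ u, MeasurableSet (B u) := fun u =>
    MeasurableSet.univ_pi fun v => (hAm u v).prod (hC'm v)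
  have hBsub : (⋃ u ∈ U, B u) ⊆
      {e | ∃! u, u ∈ U ∧ ((e u).1 : ℝ) < transmitProb b (δ u) (seed b (e s).2)} := by
    intro e he
    simp only [Set.mem_iUnion, exists_prop] at he
    obtain ⟨u, hu, he⟩ := he
    have he' : ∀ v, (e v).1 ∈ A u v ∧ (e v).2 ∈ C' v := fun v => he v (Set.mem_univ v)
    have hs : (e s).2 ∈ C := by simpa [C'] using (he' s).2
    refine ⟨u, ⟨hu, ?_⟩, ?_⟩
    · have h1 : ((e u).1 : ℝ) < pc u := by simpa [A] using (he' u).1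
      exact h1.trans_le (transmitProb_anti hs.2.le)
    · rintro v ⟨hv, hv'⟩
      by_contra hne
      have h1 : pa v ≤ ((e v).1 : ℝ) := by simpa [A, hne, hv] using (he' v).1
      exact absurd (h1.trans_lt hv') (not_lt.2 (transmitProb_anti hs.1))
  have hdisj : Set.PairwiseDisjoint (U : Set V) B := by
    intro u hu v hv huv
    refine Set.disjoint_left.2 fun e he he' => ?_
    have h1 : (e u).1 ∈ A u u := (he u (Set.mem_univ u)).1
    have h2 : (e u).1 ∈ A v u := (he' u (Set.mem_univ u)).1
    have h1' : ((e u).1 : ℝ) < pc u := by simpa [A] using h1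
    have hu' : u ∈ U := hu
    have h2' : pa u ≤ ((e u).1 : ℝ) := by simpa [A, huv, hu'] using h2
    exact absurd (h2'.trans_lt h1') (not_lt.2 (transmitProb_anti hac.le))
  have hBmeas : ∀ u ∈ U, ENNReal.ofReal ((4 ^ b / (4 ^ b + a) - 4 ^ b / (4 ^ b + c)) *
      (pc u * ∏ v ∈ U, (1 - pa v))) ≤ (Measure.pi fun _ : V => (volume : Measure Sample)) (B u) := by
    intro u hu
    rw [Measure.pi_pi]
    simp_rw [Measure.volume_eq_prod, Measure.prod_prod, Finset.prod_mul_distrib]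
    have h1 : ∏ v, volume (C' v) = volume C := by
      rw [Finset.prod_eq_single s]
      · simp [C']
      · intro v _ hv
        simp [C', hv]
      · simp
    have h2 : ENNReal.ofReal (pc u * ∏ v ∈ U, (1 - pa v)) ≤ ∏ v, volume (A u v) := by
      have hnn : ∀ v, (0 : ℝ) ≤ 1 - pa v := fun v => by linarith [hpa1 v]
      have h3 : ∏ v ∈ U, (1 - pa v) ≤ ∏ v ∈ U.erase u, (1 - pa v) := by
        rw [← Finset.mul_prod_erase U _ hu]
        exact mul_le_of_le_one_left (Finset.prod_nonneg fun v _ => hnn v) (by linarith [hpa0 u])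
      have h4 : ∏ v, volume (A u v) = ∏ v ∈ U, volume (A u v) := by
        refine (Finset.prod_subset (Finset.subset_univ U) fun v _ hv => ?_).symm
        have : v ≠ u := fun h => hv (h ▸ hu)
        simp [A, hv, this]
      rw [h4, ← Finset.mul_prod_erase U (fun v => volume (A u v)) hu]
      have h5 : volume (A u u) = ENNReal.ofReal (pc u) := by
        simp only [A, if_true]
        exact volume_coe_lt (hpc0 u).le (by linarith [hpc1 u])
      have h6 : ∏ v ∈ U.erase u, volume (A u v) = ENNReal.ofReal (∏ v ∈ U.erase u, (1 - pa v)) := by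
        rw [ENNReal.ofReal_prod_of_nonneg fun v _ => hnn v]
        refine Finset.prod_congr rfl fun v hv => ?_
        simp only [A, if_neg (Finset.ne_of_mem_erase hv), if_pos (Finset.mem_of_mem_erase hv)]
        exact volume_le_coe (hpa0 v).le (by linarith [hpa1 v])
      rw [h5, h6, ← ENNReal.ofReal_mul (hpc0 u).le]
      exact ENNReal.ofReal_le_ofReal (mul_le_mul_of_nonneg_left h3 (hpc0 u).le)
    rw [h1, mul_comm, mul_comm (∏ v, volume (A u v)), mul_comm, ENNReal.ofReal_mul hC0]
    exact mul_le_mul' (volume_seed_ge b a c) h2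
  calc _ ≤ ENNReal.ofReal (∑ u ∈ U, (4 ^ b / (4 ^ b + a) - 4 ^ b / (4 ^ b + c)) *
      (pc u * ∏ v ∈ U, (1 - pa v))) := by
        refine ENNReal.ofReal_le_ofReal ?_
        rw [← Finset.mul_sum, ← Finset.sum_mul]
        refine mul_le_mul_of_nonneg_left (mul_le_mul_of_nonneg_left ?_
          (Finset.sum_nonneg fun u _ => (hpc0 u).le)) hC0
        rw [Finset.mul_sum, ← Finset.sum_neg_distrib, Real.exp_sum]
        exact Finset.prod_le_prod (fun v _ => (Real.exp_pos _).le) fun v _ =>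
          exp_neg_two_mul_le (hpa0 v).le (hpa1 v)
    _ = ∑ u ∈ U, ENNReal.ofReal ((4 ^ b / (4 ^ b + a) - 4 ^ b / (4 ^ b + c)) *
      (pc u * ∏ v ∈ U, (1 - pa v))) := by
        refine ENNReal.ofReal_sum_of_nonneg fun u _ => mul_nonneg hC0 (mul_nonneg (hpc0 u).le
          (Finset.prod_nonneg fun v _ => by linarith [hpa1 v]))
    _ ≤ ∑ u ∈ U, (Measure.pi fun _ : V => (volume : Measure Sample)) (B u) :=
        Finset.sum_le_sum hBmeas
    _ = (Measure.pi fun _ : V => (volume : Measure Sample)) (⋃ u ∈ U, B u) :=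
        (measure_biUnion_finset hdisj fun u _ => hBm u).symm
    _ ≤ _ := measure_mono hBsub

end Success

/-! ### A window of good seeds -/

section Window

variable {V : Type*}

/-- The square root of the product of the rate and the logarithmic number of competitors. -/
noncomputable def geomRate (b d : ℕ) (k : ℝ) : ℝ := Real.sqrt (rate b d * k)

/-- A bound for the inverse probability that a node hears from its at most `exp (k - 3)` informed
in-neighbors, which have distances between `d` and `D`. -/
noncomputable def waitingTime (b d D : ℕ) (k : ℝ) : ℝ :=
  2400 * geomRate b d k * (1 + k / rate b D)

/-- The exponent `rate * α²` has derivative `2 * rate * α`, which is at most twice `geomRate` while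
the exponent is at most `k`. Hence a shift of `α` by at most `1 / (3 * geomRate)` costs at most a
factor `e`. If the exponent exceeds `k`, the probability is below the subtracted error term. -/
lemma transmitProb_add_ge {b d d' q l : ℕ} {k : ℝ} (hk : 3 ≤ k) (hd : d ≤ d')
    (hl : (l : ℝ) / 4 ^ b * (3 * geomRate b d k) ≤ 1) :
    Real.exp (-1) * (transmitProb b d' q - Real.exp (-k) / 2) ≤ transmitProb b d' (q + l) := by
  rcases le_or_gt (rate b d' * ((q : ℝ) / 4 ^ b) ^ 2) k with hq | hq
  · have hr := rate_pos b d'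
    have hr2 := rate_anti (b := b) hd
    have hg2 : geomRate b d k ^ 2 = rate b d * k :=
      Real.sq_sqrt (mul_nonneg (rate_pos b d).le (by linarith))
    have hg0 : 0 ≤ geomRate b d k := Real.sqrt_nonneg _
    set g := geomRate b d k
    set α := (q : ℝ) / 4 ^ b with hα
    set σ := (l : ℝ) / 4 ^ b with hσ
    have hα0 : 0 ≤ α := by positivity
    have hσ0 : 0 ≤ σ := by positivity
    have h1 : rate b d' * α ≤ g := by
      refine abs_le_of_sq_le_sq' ?_ hg0 |>.2
      rw [hg2]
      calc (rate b d' * α) ^ 2 = rate b d' * (rate b d' * α ^ 2) := by ring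
        _ ≤ rate b d * k := mul_le_mul hr2 hq (by positivity) (rate_pos b d).le
    have h2 : rate b d' * (α + σ) ^ 2 ≤ rate b d' * α ^ 2 + 1 := by
      have h3 : 2 * (rate b d' * α) * σ ≤ 2 / 3 := by
        have : (rate b d' * α) * σ ≤ g * σ := by gcongr
        linarith
      have h4 : rate b d' * σ ^ 2 ≤ 1 / 3 := by
        have h5 : rate b d' ≤ g ^ 2 / 3 := by
          rw [hg2]
          nlinarith [rate_pos b d]
        calc rate b d' * σ ^ 2 ≤ g ^ 2 / 3 * σ ^ 2 := by gcongr
          _ = (σ * (3 * g)) ^ 2 / 27 := by ring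
          _ ≤ 1 ^ 2 / 27 := by gcongr
          _ ≤ 1 / 3 := by norm_num
      nlinarith
    have h6 : Real.exp (-1) * transmitProb b d' q ≤ transmitProb b d' (q + l) := by
      unfold transmitProb
      rw [← mul_div_assoc, ← Real.exp_add]
      have : ((q + l : ℕ) : ℝ) / 4 ^ b = α + σ := by push_cast; ring
      rw [this]
      gcongr
      linarith
    refine le_trans ?_ h6
    have := Real.exp_pos (-k)
    gcongr
    linarith
  · have h1 : transmitProb b d' q ≤ Real.exp (-k) / 2 := by
      unfold transmitProb
      gcongr
    have h2 := transmitProb_pos b d' (q + l)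
    have h3 := Real.exp_pos (-1)
    nlinarith

/-- The choice `k = log N + 3` makes the `N` error terms add up to at most `exp (-3) / 2 ≤ 1 / 40`.
-/
lemma sum_transmitProb_add_ge {b d q l N : ℕ} {U : Finset V} {δ : V → ℕ} (hN : U.card ≤ N)
    (hd : ∀ u ∈ U, d ≤ δ u) (hN0 : N ≠ 0)
    (hl : (l : ℝ) / 4 ^ b * (3 * geomRate b d (Real.log N + 3)) ≤ 1) :
    Real.exp (-1) * (∑ u ∈ U, transmitProb b (δ u) q - 1 / 40) ≤
      ∑ u ∈ U, transmitProb b (δ u) (q + l) := by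
  have hN1 : (1 : ℝ) ≤ N := by exact_mod_cast Nat.one_le_iff_ne_zero.2 hN0
  have hk : (3 : ℝ) ≤ Real.log N + 3 := by linarith [Real.log_nonneg hN1]
  have h1 := Finset.sum_le_sum fun u (hu : u ∈ U) => transmitProb_add_ge (q := q) hk (hd u hu) hl
  refine le_trans ?_ h1
  rw [← Finset.mul_sum, Finset.sum_sub_distrib, Finset.sum_const, nsmul_eq_mul]
  refine mul_le_mul_of_nonneg_left (sub_le_sub_left ?_ _) (Real.exp_pos _).le
  have h2 : Real.exp (-(Real.log N + 3)) = (N : ℝ)⁻¹ * Real.exp (-3) := by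
    rw [neg_add, Real.exp_add, Real.exp_neg, Real.exp_log (by linarith)]
  have h3 : Real.exp (-3) ≤ 1 / 20 := by
    rw [Real.exp_neg, one_div]
    gcongr
    have := Real.exp_one_gt_d9
    calc (20 : ℝ) ≤ 2.7182818283 ^ 3 := by norm_num
      _ ≤ Real.exp 1 ^ 3 := by gcongr
      _ = Real.exp 3 := by rw [← Real.exp_nat_mul]; norm_num
  rw [h2]
  have h4 : (U.card : ℝ) ≤ N := by exact_mod_cast hN
  calc (U.card : ℝ) * ((N : ℝ)⁻¹ * Real.exp (-3) / 2) ≤ N * ((N : ℝ)⁻¹ * (1 / 20) / 2) := by gcongr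
    _ = 1 / 40 := by field_simp; norm_num

/-- A discrete intermediate value argument along multiples of `l`: `q` is the last multiple before
the sum first drops below `1 / 2`. One step shrinks the sum by little more than a factor `e`, which
bounds it above at `q` and below at `q + l`. -/
lemma exists_seed_window {b d N l : ℕ} {U : Finset V} {δ : V → ℕ} (hU : U.Nonempty)
    (hN : U.card ≤ N) (hd : ∀ u ∈ U, d ≤ δ u) (hl0 : l ≠ 0)
    (hl : (l : ℝ) / 4 ^ b * (3 * geomRate b d (Real.log N + 3)) ≤ 1) :
    ∃ q : ℕ, 1 / 2 ≤ ∑ u ∈ U, transmitProb b (δ u) q ∧ 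
      ∑ u ∈ U, transmitProb b (δ u) q ≤ 1.4 ∧ 0.17 ≤ ∑ u ∈ U, transmitProb b (δ u) (q + l) := by
  have hN0 : N ≠ 0 := by
    have := hU.card_pos
    omega
  have hlim : Filter.Tendsto (fun j : ℕ => ∑ u ∈ U, transmitProb b (δ u) (j * l)) Filter.atTop
      (nhds 0) := by
    rw [← Finset.sum_const_zero (s := U)]
    refine tendsto_finsetSum _ fun u _ => ?_
    unfold transmitProb
    rw [← zero_div 2]
    refine Filter.Tendsto.div_const (Real.tendsto_exp_atBot.comp ?_) 2
    rw [Filter.tendsto_neg_atBot_iff]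
    refine Filter.Tendsto.const_mul_atTop (rate_pos _ _) ?_
    refine (Filter.tendsto_pow_atTop two_ne_zero).comp ?_
    refine Filter.Tendsto.atTop_div_const (by positivity) ?_
    push_cast
    exact Filter.Tendsto.atTop_mul_const (by positivity) tendsto_natCast_atTop_atTop
  have hex : ∃ j : ℕ, ∑ u ∈ U, transmitProb b (δ u) (j * l) < 1 / 2 :=
    ((hlim.eventually (gt_mem_nhds (by norm_num : (0 : ℝ) < 1 / 2)))).exists
  have h0 : 1 / 2 ≤ ∑ u ∈ U, transmitProb b (δ u) (0 * l) := by
    have : ∀ u ∈ U, transmitProb b (δ u) (0 * l) = 1 / 2 := by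
      intro u _
      simp [transmitProb]
    rw [Finset.sum_congr rfl this, Finset.sum_const, nsmul_eq_mul]
    have : (1 : ℝ) ≤ U.card := by exact_mod_cast hU.card_pos
    linarith
  classical
  obtain ⟨j, hj⟩ : ∃ j, Nat.find hex = j + 1 := by
    refine Nat.exists_eq_succ_of_ne_zero fun h => ?_
    have := Nat.find_spec hex
    rw [h] at this
    linarith
  have h1 : 1 / 2 ≤ ∑ u ∈ U, transmitProb b (δ u) (j * l) := not_lt.1 (Nat.find_min hex (by omega))
  have h2 := Nat.find_spec hex
  rw [hj, Nat.succ_mul] at h2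
  have h3 := sum_transmitProb_add_ge (q := j * l) hN hd hN0 hl
  have h4 : Real.exp (-1) * Real.exp 1 = 1 := by rw [← Real.exp_add]; simp
  have h5 := Real.exp_one_lt_d9
  have h6 := Real.exp_pos 1
  have h7 : 0.367 ≤ Real.exp (-1) := by nlinarith
  refine ⟨j * l, h1, ?_, ?_⟩
  · nlinarith
  · nlinarith

lemma waitingTime_pos {b d D : ℕ} {k : ℝ} (hk : 0 < k) : 0 < waitingTime b d D k := by
  have h1 := rate_pos b d
  have h2 := rate_pos b D
  have h3 : 0 < geomRate b d k := Real.sqrt_pos.2 (by positivity)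
  unfold waitingTime
  positivity

/-- On the window the expected number of transmitters has constant order, so success there has
probability at least `1 / 100`. The rest of `waitingTime` is the inverse probability of hitting the
window, from its length and its distance from `0`. The hypothesis `Real.log N + 3 ≤ 2 ^ b` keeps the
window longer than the integer resolution of the seed. -/
theorem measure_success_ge [Fintype V] (s : V) {b d D N : ℕ} {U : Finset V} {δ : V → ℕ} (hU : U.Nonempty)
    (hN : U.card ≤ N) (hd : ∀ u ∈ U, d ≤ δ u) (hD : ∀ u ∈ U, δ u ≤ D) (hDb : D ≤ 4 ^ b)
    (hb : 2 ≤ b) (hNb : Real.log N + 3 ≤ 2 ^ b) :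
    ENNReal.ofReal (1 / waitingTime b d D (Real.log N + 3)) ≤
    (Measure.pi fun _ : V => (volume : Measure Sample))
      {e | ∃! u, u ∈ U ∧ ((e u).1 : ℝ) < transmitProb b (δ u) (seed b (e s).2)} := by
  have hN0 : N ≠ 0 := by
    have := hU.card_pos
    omega
  have hN1 : (1 : ℝ) ≤ N := by exact_mod_cast Nat.one_le_iff_ne_zero.2 hN0
  have hk : (3 : ℝ) ≤ Real.log N + 3 := by linarith [Real.log_nonneg hN1]
  set k := Real.log N + 3 with hkdef
  set g := geomRate b d k with hg
  have hdD : d ≤ D := by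
    obtain ⟨u, hu⟩ := hU
    exact (hd u hu).trans (hD u hu)
  have hM : (0 : ℝ) < 4 ^ b := by positivity
  have hg1 : 1 ≤ g := by
    rw [hg, geomRate, Real.one_le_sqrt]
    have := half_le_rate (hdD.trans hDb)
    nlinarith
  have hg2 : g ≤ 2 ^ b := by
    rw [hg, geomRate]
    refine Real.sqrt_le_iff.2 ⟨by positivity, ?_⟩
    rw [sq]
    exact mul_le_mul (rate_le_two_pow b d) hNb (by linarith) (by positivity)
  have hg3 : 3 * g ≤ 4 ^ b := by
    rw [four_pow_eq]
    have : (4 : ℝ) ≤ 2 ^ b := by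
      calc (4 : ℝ) = 2 ^ 2 := by norm_num
        _ ≤ 2 ^ b := by gcongr; norm_num
    nlinarith
  -- The longest integer window allowed; being at least `1` before rounding, it loses at most a
  -- factor `2` by rounding.
  set l := ⌊(4 : ℝ) ^ b / (3 * g)⌋₊ with hl
  have hx1 : 1 ≤ (4 : ℝ) ^ b / (3 * g) := by rw [le_div_iff₀ (by linarith)]; linarith
  have hl1 : 1 ≤ l := Nat.le_floor (by simpa using hx1)
  have hlle : (l : ℝ) ≤ 4 ^ b / (3 * g) := Nat.floor_le (by positivity)
  have hlge : 4 ^ b / (6 * g) ≤ (l : ℝ) := by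
    have h1 : (4 : ℝ) ^ b / (3 * g) < l + 1 := Nat.lt_floor_add_one _
    have h2 : (1 : ℝ) ≤ l := by exact_mod_cast hl1
    have h3 : (4 : ℝ) ^ b / (6 * g) = (4 ^ b / (3 * g)) / 2 := by
      field_simp; norm_num
    rw [h3]
    linarith
  set σ := (l : ℝ) / 4 ^ b with hσ
  have hσ1 : σ * (3 * g) ≤ 1 := by
    rw [hσ, div_mul_eq_mul_div, div_le_one hM]
    rwa [le_div_iff₀ (by linarith)] at hlle
  have hσ2 : 1 / (6 * g) ≤ σ := by
    rw [hσ, le_div_iff₀ hM]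
    calc 1 / (6 * g) * 4 ^ b = 4 ^ b / (6 * g) := by ring
      _ ≤ l := hlge
  have hσ0 : 0 ≤ σ := by positivity
  have hσ3 : σ ≤ 1 := by nlinarith
  obtain ⟨q, hq1, hq2, hq3⟩ := exists_seed_window (b := b) hU hN hd (by omega : l ≠ 0) hσ1
  set α := (q : ℝ) / 4 ^ b with hα
  have hα0 : 0 ≤ α := by positivity
  have hrD := rate_pos b D
  -- Otherwise every competitor would transmit with probability below `1 / (2 * N)`, contradicting
  -- that the sum at `q` is at least `1 / 2`.
  have hα2 : α ^ 2 ≤ k / rate b D := by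
    by_contra! hcon
    rw [div_lt_iff₀ hrD] at hcon
    have h1 : ∀ u ∈ U, transmitProb b (δ u) q < 1 / (2 * N) := by
      intro u hu
      have h2 : k < rate b (δ u) * α ^ 2 := by
        calc k < α ^ 2 * rate b D := hcon
          _ ≤ α ^ 2 * rate b (δ u) := by gcongr; exact rate_anti (hD u hu)
          _ = _ := by ring
      have h3 : Real.exp (-(rate b (δ u) * α ^ 2)) < (N : ℝ)⁻¹ := by
        rw [← Real.exp_log (inv_pos.2 (by linarith : (0 : ℝ) < N)), Real.log_inv]
        exact Real.exp_lt_exp.2 (by linarith)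
      unfold transmitProb
      calc Real.exp (-(rate b (δ u) * α ^ 2)) / 2 < (N : ℝ)⁻¹ / 2 := by linarith
        _ = 1 / (2 * N) := by rw [one_div, mul_inv]; ring
    have h2 := Finset.sum_lt_sum_of_nonempty hU h1
    rw [Finset.sum_const, nsmul_eq_mul] at h2
    have h3 : (U.card : ℝ) * (1 / (2 * N)) ≤ N * (1 / (2 * N)) := by
      have : (U.card : ℝ) ≤ N := by exact_mod_cast hN
      gcongr
    have h4 : (N : ℝ) * (1 / (2 * N)) = 1 / 2 := by field_simp
    linarith
  refine le_trans (ENNReal.ofReal_le_ofReal ?_) (measure_existsUnique_ge s U δ b q (q + l))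
  have hP : 1 / (24 * g * (1 + k / rate b D)) ≤
      4 ^ b / (4 ^ b + q) - 4 ^ b / (4 ^ b + ((q + l : ℕ) : ℝ)) := by
    have h1 : (4 : ℝ) ^ b / (4 ^ b + q) = 1 / (1 + α) := by
      rw [hα]; field_simp
    have h2 : (4 : ℝ) ^ b / (4 ^ b + ((q + l : ℕ) : ℝ)) = 1 / (1 + α + σ) := by
      rw [hα, hσ]; push_cast; field_simp; ring
    rw [h1, h2, div_sub_div _ _ (by positivity) (by positivity)]
    calc 1 / (24 * g * (1 + k / rate b D)) = 1 / (6 * g) / (4 * (1 + k / rate b D)) := by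
          rw [div_div]; ring
      _ ≤ σ / (4 * (1 + α ^ 2)) := by gcongr
      _ ≤ σ / ((1 + α) * (1 + α + σ)) := by
          refine div_le_div_of_nonneg_left hσ0 (by positivity) ?_
          nlinarith [sq_nonneg (α - 1)]
      _ = _ := by ring
  have hS : 1 / 100 ≤ (∑ u ∈ U, transmitProb b (δ u) (q + l)) *
      Real.exp (-(2 * ∑ u ∈ U, transmitProb b (δ u) q)) := by
    have h1 : Real.exp (-2.8) ≤ Real.exp (-(2 * ∑ u ∈ U, transmitProb b (δ u) q)) :=
      Real.exp_le_exp.2 (by linarith)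
    have h2 : 0.06 ≤ Real.exp (-2.8) := by
      have h3 := Real.exp_one_lt_d9
      have h4 : Real.exp (2.8) ≤ 1 / 0.06 := by
        have h5 : Real.exp 2.8 ^ 5 ≤ (1 / 0.06) ^ 5 := by
          calc Real.exp 2.8 ^ 5 = Real.exp 1 ^ 14 := by
                rw [← Real.exp_nat_mul, ← Real.exp_nat_mul]; norm_num
            _ ≤ 2.7182818286 ^ 14 := by gcongr
            _ ≤ (1 / 0.06) ^ 5 := by norm_num
        exact le_of_pow_le_pow_left₀ (by norm_num) (by norm_num) h5
      rw [Real.exp_neg]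
      calc (0.06 : ℝ) = (1 / 0.06)⁻¹ := by norm_num
        _ ≤ _ := inv_anti₀ (Real.exp_pos _) h4
    calc (1 : ℝ) / 100 ≤ 0.17 * 0.06 := by norm_num
      _ ≤ _ := mul_le_mul hq3 (h2.trans h1) (by norm_num) (by linarith)
  calc 1 / waitingTime b d D k = 1 / (24 * g * (1 + k / rate b D)) * (1 / 100) := by
        rw [waitingTime, ← hg, one_div_mul_one_div]; ring
    _ ≤ _ := mul_le_mul hP hS (by norm_num) (le_trans (by positivity) hP)

end Window

/-! ### Progress along a shortest path -/

section Progress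

variable {V : Type*} {G : Digraph V} {s : V} {δ : V → ℕ}

lemma exists_shortest_path (hδ : IsHopDistance G s δ) (d : ℕ) (v : V) (hv : δ v = d) :
    ∃ w : ℕ → V, w d = v ∧ (∀ i ≤ d, δ (w i) = i) ∧ ∀ i < d, G.Adj (w i) (w (i + 1)) := by
  induction d generalizing v with
  | zero => exact ⟨fun _ => v, rfl, fun i hi => by rw [hv]; omega, fun i hi => by omega⟩
  | succ d ih =>
    have hvs : v ≠ s := fun h => by
      rw [(hδ.eq_source v).2 h] at hv
      omega
    obtain ⟨u, hu, huv⟩ := hδ.exists_parent v hvs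
    obtain ⟨w, hw, hw1, hw2⟩ := ih u (by omega)
    refine ⟨fun i => if i ≤ d then w i else v, by simp, fun i hi => ?_, fun i hi => ?_⟩
    · by_cases h : i ≤ d
      · simp [h, hw1 i h]
      · simp only [h, if_false]
        omega
    · by_cases h : i + 1 ≤ d
      · simp only [h, show i ≤ d by omega, if_true]
        exact hw2 i h
      · obtain rfl : i = d := by omega
        simpa [hw] using hu

open Classical in
/-- The index of the last vertex of the path `w` up to `d` that `u` can inform directly. -/
noncomputable def reach (G : Digraph V) (w : ℕ → V) (d : ℕ) (u : V) : ℕ :=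
  ((Finset.Icc 1 d).filter fun i => G.Adj u (w i)).sup id

lemma reach_le (w : ℕ → V) (d : ℕ) (u : V) : reach G w d u ≤ d := by
  classical
  refine Finset.sup_le fun i hi => ?_
  exact (Finset.mem_Icc.1 (Finset.mem_filter.1 hi).1).2

lemma le_reach {w : ℕ → V} {d i : ℕ} {u : V} (h1 : 1 ≤ i) (hd : i ≤ d) (h : G.Adj u (w i)) :
    i ≤ reach G w d u := by
  classical
  exact Finset.le_sup (f := id) (Finset.mem_filter.2 ⟨Finset.mem_Icc.2 ⟨h1, hd⟩, h⟩)

lemma adj_reach {w : ℕ → V} {d : ℕ} {u : V} (h : reach G w d u ≠ 0) :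
    G.Adj u (w (reach G w d u)) := by
  classical
  have hne : ((Finset.Icc 1 d).filter fun i => G.Adj u (w i)).Nonempty := by
    by_contra hne
    rw [Finset.not_nonempty_iff_eq_empty] at hne
    exact h (by simp [reach, hne])
  obtain ⟨i, hi, hi'⟩ := Finset.exists_mem_eq_sup _ hne id
  unfold reach
  rw [hi']
  exact (Finset.mem_filter.1 hi).2

variable [Fintype V]

lemma measurable_of_transmitters {α : Type*} [MeasurableSpace α] (s : V) (δ : V → ℕ) (b : ℕ)
    (f : (V → Prop) → α) : Measurable fun e : V → Sample =>
      f fun u => ((e u).1 : ℝ) < transmitProb b (δ u) (seed b (e s).2) := by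
  refine (measurable_of_countable f).comp (measurable_pi_lambda _ fun u => ?_)
  refine measurableSet_setOfPred.1 (measurableSet_lt (by fun_prop) ?_)
  exact (measurable_of_countable (transmitProb b (δ u))).comp
    ((measurable_seed b).comp (by fun_prop))

/-- The potential of a set of informed nodes: it vanishes once the target is informed. -/
noncomputable def potential (f : ℕ → ℝ) (v : V) (lead : Finset V → ℕ) (d : ℕ)
    (x : Finset V) : ENNReal :=
  open Classical in if v ∈ x then 0 else ENNReal.ofReal (∏ j ∈ Finset.Icc (lead x) d, f j)

lemma prod_Icc_anti {f : ℕ → ℝ} {d i j : ℕ} (hf : ∀ k ∈ Finset.Icc i d, 1 ≤ f k) (hij : i ≤ j) :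
    ∏ k ∈ Finset.Icc j d, f k ≤ ∏ k ∈ Finset.Icc i d, f k := by
  refine Finset.prod_le_prod_of_subset_of_one_le (Finset.Icc_subset_Icc_left hij)
    (fun k hk => ?_) fun k hk _ => ?_
  · exact zero_le_one.trans (hf k (Finset.Icc_subset_Icc_left hij hk))
  · exact hf k hk

lemma one_le_prod_Icc {f : ℕ → ℝ} {d i : ℕ} (hf : ∀ k ∈ Finset.Icc i d, 1 ≤ f k) :
    1 ≤ ∏ k ∈ Finset.Icc i d, f k := by
  calc (1 : ℝ) = ∏ k ∈ Finset.Icc i d, 1 := by simp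
    _ ≤ _ := Finset.prod_le_prod (fun _ _ => zero_le_one) hf

/-- An event of probability at least `1 / g` on which the potential loses the fraction `β * g`
yields an expected loss of at least the fraction `β`. -/
lemma lintegral_le_of_event {E : Type*} [MeasurableSpace E] (Q : Measure E)
    [IsProbabilityMeasure Q] {S : Set E} (hS : MeasurableSet S) {h : E → ENNReal} {y β g : ℝ}
    (hy : 0 ≤ y) (hβ : 0 ≤ β) (hg : 0 < g) (hβg : β * g ≤ 1 / 2)
    (hp : ENNReal.ofReal (1 / g) ≤ Q S) (h1 : ∀ e ∈ S, h e ≤ ENNReal.ofReal ((1 - β * g) * y))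
    (h2 : ∀ e, h e ≤ ENNReal.ofReal y) :
    ∫⁻ e, h e ∂Q ≤ ENNReal.ofReal (1 - β) * ENNReal.ofReal y := by
  classical
  have hp' : 1 / g ≤ Q.real S := by
    rw [Measure.real, ← ENNReal.ofReal_le_iff_le_toReal (measure_ne_top _ _)]
    exact hp
  have hle : ∀ e, h e ≤ S.indicator (fun _ => ENNReal.ofReal ((1 - β * g) * y)) e +
      Sᶜ.indicator (fun _ => ENNReal.ofReal y) e := by
    intro e
    by_cases he : e ∈ S
    · simpa [he] using h1 e he
    · simpa [he] using h2 e
  have h3 : 1 ≤ Q.real S * g := by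
    rwa [div_le_iff₀ hg] at hp'
  have h4 : Q.real S ≤ 1 := measureReal_le_one
  calc ∫⁻ e, h e ∂Q ≤ ∫⁻ e, (S.indicator (fun _ => ENNReal.ofReal ((1 - β * g) * y)) e +
      Sᶜ.indicator (fun _ => ENNReal.ofReal y) e) ∂Q := lintegral_mono hle
    _ = ENNReal.ofReal ((1 - β * g) * y) * Q S + ENNReal.ofReal y * Q Sᶜ := by
        rw [lintegral_add_left (measurable_const.indicator hS), lintegral_indicator_const hS,
          lintegral_indicator_const hS.compl]
    _ = ENNReal.ofReal ((1 - β * g) * y * Q.real S + y * (1 - Q.real S)) := by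
        rw [ENNReal.ofReal_add (mul_nonneg (mul_nonneg (by linarith) hy) measureReal_nonneg)
          (mul_nonneg hy (by linarith)), ENNReal.ofReal_mul (mul_nonneg (by linarith) hy),
          ENNReal.ofReal_mul hy, ← probReal_compl_eq_one_sub hS, ofReal_measureReal,
          ofReal_measureReal]
    _ ≤ ENNReal.ofReal ((1 - β) * y) := by
        refine ENNReal.ofReal_le_ofReal ?_
        have : 0 ≤ β * y * (Q.real S * g - 1) := by
          have : 0 ≤ Q.real S * g - 1 := by linarith
          positivity
        nlinarith
    _ ≤ ENNReal.ofReal (1 - β) * ENNReal.ofReal y := by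
        rw [ENNReal.ofReal_mul' hy]

open Classical in
/-- The probability that a node is not informed in time, in terms of bounds for the waiting times
along a shortest path. -/
theorem measure_notMem_phaseSet_le (hδ : IsHopDistance G s δ) {b D : ℕ} (hD : ∀ u, δ u ≤ D)
    (hDb : D ≤ 4 ^ b) (hb : 2 ≤ b) (hVb : Real.log (Fintype.card V) + 3 ≤ 2 ^ b)
    {v : V} (hvs : v ≠ s) :
    ∃ N : ℕ → ℕ, ∑ j ∈ Finset.Icc 1 (δ v), N j ≤ Fintype.card V ∧ ∀ β : ℝ, 0 ≤ β → β ≤ 1 →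
      (∀ j ∈ Finset.Icc 1 (δ v), β * waitingTime b (j - 1) D (Real.log (N j) + 3) ≤ 1 / 2) →
      ∀ k : ℕ, (Measure.pi fun _ : V => Measure.infinitePi fun _ : ℕ => (volume : Measure Sample))
        {ω | v ∉ phaseSet G s δ b k ω} ≤ ENNReal.ofReal (Real.exp (-(β * k) +
          2 * β * ∑ j ∈ Finset.Icc 1 (δ v), waitingTime b (j - 1) D (Real.log (N j) + 3))) := by
  obtain ⟨w, hwv, hwδ, hw⟩ := exists_shortest_path hδ (δ v) v rfl
  set d := δ v with hd
  have hd1 : 1 ≤ d := Nat.one_le_iff_ne_zero.2 fun h => hvs ((hδ.eq_source v).1 h)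
  set R := reach G w d with hR
  -- Each node is charged to one index only, which is why the numbers of competitors sum to at most
  -- the number of nodes.
  let N : ℕ → ℕ := fun j => (Finset.univ.filter fun u => R u = j).card
  have hNle : ∀ j, N j ≤ Fintype.card V := fun j => Finset.card_le_univ _
  refine ⟨N, ?_, fun β hβ0 hβ1 hβ k => ?_⟩
  · rw [Finset.sum_card_fiberwise_eq_card_filter]
    exact Finset.card_le_univ _
  let _ : MeasurableSpace (Finset V) := ⊤
  set g : ℕ → ℝ := fun j => waitingTime b (j - 1) D (Real.log (N j) + 3) with hg
  have hg0 : ∀ j, 0 < g j := fun j => waitingTime_pos (by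
    have := Real.log_natCast_nonneg (N j)
    linarith)
  -- The factor of hop `j` is chosen so that completing the hop reduces the potential by the
  -- fraction `β * g j`.
  let f : ℕ → ℝ := fun j => (1 - β * g j)⁻¹
  have hf0 : ∀ j ∈ Finset.Icc 1 d, 0 < 1 - β * g j := fun j hj => by linarith [hβ j hj]
  have hf1 : ∀ j ∈ Finset.Icc 1 d, 1 ≤ f j := fun j hj =>
    (one_le_inv₀ (hf0 j hj)).2 (by have := mul_nonneg hβ0 (hg0 j).le; linarith)
  let lead : Finset V → ℕ := fun x => x.sup R
  have hlead1 : ∀ x : Finset V, s ∈ x → 1 ≤ lead x := by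
    intro x hx
    have h0 : w 0 = s := (hδ.eq_source _).1 (hwδ 0 (Nat.zero_le _))
    have h1 : G.Adj s (w 1) := by
      have := hw 0 (by omega)
      rwa [h0] at this
    exact (le_reach le_rfl hd1 h1).trans (Finset.le_sup (f := R) hx)
  have hlead_le : ∀ x : Finset V, lead x ≤ d := fun x => Finset.sup_le fun u _ => reach_le w d u
  have hlead_mono : ∀ x y : Finset V, x ⊆ y → lead x ≤ lead y := fun x y h => Finset.sup_mono h
  have hsub : ∀ i, 1 ≤ i → ∀ j ∈ Finset.Icc i d, 1 ≤ f j := fun i hi j hj =>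
    hf1 j (Finset.Icc_subset_Icc_left hi hj)
  let W := potential f v lead d
  have hstep_sub : ∀ (x : Finset V) e, x ⊆ phaseStep G s δ b x e := fun x e =>
    Finset.subset_union_left
  have hdrift : ∀ x : Finset V, s ∈ x →
      ∫⁻ e, W (phaseStep G s δ b x e) ∂(Measure.pi fun _ : V => (volume : Measure Sample)) ≤
        ENNReal.ofReal (1 - β) * W x := by
    intro x hsx
    by_cases hvx : v ∈ x
    · have : ∀ e, W (phaseStep G s δ b x e) = 0 := fun e => if_pos (hstep_sub x e hvx)
      simp [this]
    set j := lead x with hj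
    have hj1 : 1 ≤ j := hlead1 x hsx
    have hjd : j ≤ d := hlead_le x
    have hjm : j ∈ Finset.Icc 1 d := Finset.mem_Icc.2 ⟨hj1, hjd⟩
    let U : Finset V := x.filter fun u => G.Adj u (w j)
    -- No informed node reaches beyond the lead `j`, and an in-neighbour of `w j` reaches at least
    -- `j`; so all actual competitors are charged to `j`.
    have hUR : ∀ u ∈ U, R u = j := by
      intro u hu
      obtain ⟨hu1, hu2⟩ := Finset.mem_filter.1 hu
      exact le_antisymm (Finset.le_sup (f := R) hu1) (le_reach hj1 hjd hu2)
    have hUne : U.Nonempty := by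
      obtain ⟨u, hu, huj⟩ := Finset.exists_mem_eq_sup x ⟨s, hsx⟩ R
      have h1 : R u = j := huj.symm
      refine ⟨u, Finset.mem_filter.2 ⟨hu, ?_⟩⟩
      rw [← h1]
      exact adj_reach (by change R u ≠ 0; omega)
    have hUN : U.card ≤ N j := Finset.card_le_card fun u hu =>
      Finset.mem_filter.2 ⟨Finset.mem_univ u, hUR u hu⟩
    have hNj : N j ≠ 0 := by
      have := hUne.card_pos
      omega
    have hUd : ∀ u ∈ U, j - 1 ≤ δ u := by
      intro u hu
      have h1 := hδ.le_succ u (w j) (Finset.mem_filter.1 hu).2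
      rw [hwδ j hjd] at h1
      omega
    have hNb : Real.log (N j) + 3 ≤ 2 ^ b := by
      refine le_trans ?_ hVb
      have h1 : (0 : ℝ) < N j := by exact_mod_cast Nat.pos_of_ne_zero hNj
      have h2 : (N j : ℝ) ≤ Fintype.card V := by exact_mod_cast hNle j
      gcongr
    set S : Set (V → Sample) :=
      {e | ∃! u, u ∈ U ∧ ((e u).1 : ℝ) < transmitProb b (δ u) (seed b (e s).2)} with hS
    have hSm : MeasurableSet S := measurableSet_setOfPred.2
      (measurable_of_transmitters s δ b fun T => ∃! u, u ∈ U ∧ T u)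
    have hp := measure_success_ge s hUne hUN hUd (fun u _ => hD u) hDb hb hNb
    have hWx : W x = ENNReal.ofReal (∏ i ∈ Finset.Icc j d, f i) := if_neg hvx
    have hprod : ∏ i ∈ Finset.Icc j d, f i = f j * ∏ i ∈ Finset.Icc (j + 1) d, f i := by
      rw [← Finset.insert_Icc_add_one_left_eq_Icc hjd, Finset.prod_insert (by simp)]
    rw [hWx]
    refine lintegral_le_of_event _ hSm (zero_le_one.trans (one_le_prod_Icc (hsub j hj1))) hβ0
      (hg0 j) (hβ j hjm) hp (fun e he => ?_) fun e => ?_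
    · have hwj : w j ∈ phaseStep G s δ b x e := by
        refine Finset.mem_union_right _ (Finset.mem_filter.2 ⟨Finset.mem_univ _, ?_⟩)
        refine (existsUnique_congr fun u => ?_).1 he
        simp only [U, Finset.mem_filter]
        tauto
      simp only [W, potential]
      split_ifs with hve
      · exact zero_le
      refine ENNReal.ofReal_le_ofReal ?_
      -- If `j = d`, the newly informed vertex is `v` itself. Otherwise `w j` reaches its successor
      -- on the path and the lead grows.
      have hlt : j < d := by
        refine lt_of_le_of_ne hjd fun h => hve ?_
        rw [← hwv, ← h]
        exact hwj
      have h1 : j + 1 ≤ lead (phaseStep G s δ b x e) :=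
        (le_reach (by omega) hlt (hw j hlt)).trans (Finset.le_sup (f := R) hwj)
      refine (prod_Icc_anti (hsub (j + 1) (by omega)) h1).trans (le_of_eq ?_)
      rw [hprod, ← mul_assoc, mul_inv_cancel₀ (hf0 j hjm).ne', one_mul]
    · simp only [W, potential]
      split_ifs with hve
      · exact zero_le
      refine ENNReal.ofReal_le_ofReal (prod_Icc_anti (hsub j hj1) ?_)
      exact hlead_mono _ _ (hstep_sub x e)
  have hpot := lintegral_potential_le (volume : Measure Sample) (phaseStep G s δ b)
    (fun x => by
      exact measurable_of_transmitters s δ b fun T =>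
        x ∪ Finset.univ.filter fun v => ∃! u, G.Adj u v ∧ u ∈ x ∧ T u)
    {s} (4 ^ b) (phaseSet G s δ b) (fun _ => rfl) (fun _ _ => rfl) (fun x => s ∈ x)
    (fun t ω => source_mem_phaseSet b t) W (ENNReal.ofReal (1 - β)) hdrift k
  calc _ = ∫⁻ ω, {ω | v ∉ phaseSet G s δ b k ω}.indicator 1 ω
        ∂(Measure.pi fun _ : V => Measure.infinitePi fun _ : ℕ => (volume : Measure Sample)) := by
        rw [lintegral_indicator_one]
        have hm := (indepFun_of_driven (volume : Measure Sample) (phaseStep G s δ b)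
          (fun x => by
            exact measurable_of_transmitters s δ b fun T =>
              x ∪ Finset.univ.filter fun v => ∃! u, G.Adj u v ∧ u ∈ x ∧ T u)
          {s} (4 ^ b) (phaseSet G s δ b) (fun _ => rfl) (fun _ _ => rfl) k).1
        exact hm (MeasurableSpace.measurableSet_top (s := {x : Finset V | v ∉ x}))
    _ ≤ ∫⁻ ω, W (phaseSet G s δ b k ω)
        ∂(Measure.pi fun _ : V => Measure.infinitePi fun _ : ℕ => (volume : Measure Sample)) := by
        refine lintegral_mono fun ω => ?_
        by_cases hv : v ∈ phaseSet G s δ b k ω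
        · simp [hv]
        · have h1 : W (phaseSet G s δ b k ω) =
            ENNReal.ofReal (∏ i ∈ Finset.Icc (lead (phaseSet G s δ b k ω)) d, f i) := if_neg hv
          have h2 := one_le_prod_Icc (hsub _ (hlead1 (phaseSet G s δ b k ω)
            (source_mem_phaseSet b k)))
          rw [h1]
          simpa [hv] using h2
    _ ≤ ENNReal.ofReal (1 - β) ^ k * W {s} := hpot
    _ ≤ ENNReal.ofReal (Real.exp (-(β * k))) * ENNReal.ofReal (Real.exp
          (2 * β * ∑ j ∈ Finset.Icc 1 d, g j)) := by
        refine mul_le_mul' ?_ ?_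
        · rw [← ENNReal.ofReal_pow (by linarith)]
          refine ENNReal.ofReal_le_ofReal ?_
          have h1 : 1 - β ≤ Real.exp (-β) := Real.one_sub_le_exp_neg β
          calc (1 - β) ^ k ≤ Real.exp (-β) ^ k := by
                gcongr
            _ = Real.exp (-(β * k)) := by rw [← Real.exp_nat_mul]; ring_nf
        · have h1 : W {s} ≤ ENNReal.ofReal (∏ i ∈ Finset.Icc (lead {s}) d, f i) := by
            simp only [W, potential]
            split_ifs
            · exact zero_le
            · exact le_rfl
          refine h1.trans (ENNReal.ofReal_le_ofReal ?_)
          refine (prod_Icc_anti hf1 (hlead1 {s} (Finset.mem_singleton_self s))).trans ?_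
          rw [Finset.mul_sum, Real.exp_sum]
          refine Finset.prod_le_prod (fun j hj => zero_le_one.trans (hf1 j hj)) fun j hj => ?_
          refine inv_le_of_inv_le₀ (Real.exp_pos _) ?_
          rw [← Real.exp_neg, mul_assoc]
          exact exp_neg_two_mul_le (mul_nonneg hβ0 (hg0 j).le) (hβ j hj)
    _ = _ := by rw [← ENNReal.ofReal_mul (Real.exp_pos _).le, ← Real.exp_add]

end Progress

/-! ### Summing the waiting times -/

section Estimates

lemma one_le_lg (x : ℝ) : 1 ≤ lg x := le_max_right _ _

lemma log_le_lg {x : ℝ} (hx : 0 < x) : Real.log x ≤ lg x := by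
  rcases le_or_gt x 1 with h | h
  · exact (Real.log_nonpos hx.le h).trans (zero_le_one.trans (one_le_lg x))
  · refine le_trans ?_ (le_max_left _ _)
    rw [Real.logb, le_div_iff₀ (Real.log_pos one_lt_two)]
    have h1 := Real.log_pos h
    have h2 := Real.log_two_lt_d9
    nlinarith

lemma lg_eq_logb {n : ℕ} (hn : 2 ≤ n) : lg n = Real.logb 2 n := by
  have hn' : (2 : ℝ) ≤ n := by exact_mod_cast hn
  refine max_eq_left ?_
  rw [Real.le_logb_iff_rpow_le one_lt_two (by linarith)]
  simpa using hn'

lemma lg_pow_eight_le {n : ℕ} (hn : 2 ≤ n) : lg n ^ 8 ≤ 256 * 40320 * n := by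
  have hn' : (2 : ℝ) ≤ n := by exact_mod_cast hn
  have h0 : 0 ≤ Real.log n := Real.log_nonneg (by linarith)
  have h1 : lg n ≤ 2 * Real.log n := by
    rw [lg_eq_logb hn, Real.logb, div_le_iff₀ (Real.log_pos one_lt_two)]
    have := Real.log_two_gt_d9
    nlinarith
  have h2 : Real.log n ^ 8 / (Nat.factorial 8 : ℕ) ≤ n := by
    calc _ ≤ Real.exp (Real.log n) := Real.pow_div_factorial_le_exp _ h0 8
      _ = n := Real.exp_log (by linarith)
  have h3 : ((Nat.factorial 8 : ℕ) : ℝ) = 40320 := by norm_num [Nat.factorial]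
  rw [h3, div_le_iff₀ (by norm_num)] at h2
  calc lg n ^ 8 ≤ (2 * Real.log n) ^ 8 := by
        gcongr
        exact zero_le_one.trans (one_le_lg _)
    _ = 256 * Real.log n ^ 8 := by ring
    _ ≤ 256 * (n * 40320) := by gcongr
    _ = _ := by ring

/-- A telescoping comparison: for consecutive fourth roots `x ≤ y` one has `1 = y ^ 4 - x ^ 4 ≤ 4 *
y ^ 3 * (y - x)`. -/
lemma sum_inv_fourthRoot_cubed_le (d : ℕ) :
    ∑ j ∈ Finset.Icc 1 d, 1 / Real.sqrt (Real.sqrt j) ^ 3 ≤ 4 * Real.sqrt (Real.sqrt d) := by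
  have h4 : ∀ x : ℝ, 0 ≤ x → Real.sqrt (Real.sqrt x) ^ 4 = x := by
    intro x hx
    rw [show (4 : ℕ) = 2 * 2 by norm_num, pow_mul, Real.sq_sqrt (Real.sqrt_nonneg x),
      Real.sq_sqrt hx]
  induction d with
  | zero => simp
  | succ d ih =>
    rw [Finset.sum_Icc_succ_top (by omega)]
    set x := Real.sqrt (Real.sqrt (d : ℝ)) with hx
    set y := Real.sqrt (Real.sqrt ((d + 1 : ℕ) : ℝ)) with hy
    have hx4 : x ^ 4 = d := h4 d (Nat.cast_nonneg d)
    have hy4 : y ^ 4 = d + 1 := by rw [hy, h4 _ (Nat.cast_nonneg _)]; push_cast; rfl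
    have hx0 : 0 ≤ x := Real.sqrt_nonneg _
    have hy0 : 0 < y := Real.sqrt_pos.2 (Real.sqrt_pos.2 (by positivity))
    have hxy : x ≤ y := Real.sqrt_le_sqrt (Real.sqrt_le_sqrt (by push_cast; linarith))
    have h1 : 1 / y ^ 3 ≤ 4 * (y - x) := by
      rw [div_le_iff₀ (by positivity)]
      have h2 : 1 = (y - x) * (y ^ 3 + y ^ 2 * x + y * x ^ 2 + x ^ 3) := by
        linear_combination hx4 - hy4
      have h3 : y ^ 3 + y ^ 2 * x + y * x ^ 2 + x ^ 3 ≤ 4 * y ^ 3 := by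
        have ha : y ^ 2 * x ≤ y ^ 2 * y := by gcongr
        have hb : y * x ^ 2 ≤ y * y ^ 2 := by gcongr
        have hc : x ^ 3 ≤ y ^ 3 := by gcongr
        nlinarith
      calc 1 = (y - x) * (y ^ 3 + y ^ 2 * x + y * x ^ 2 + x ^ 3) := h2
        _ ≤ (y - x) * (4 * y ^ 3) := by
            refine mul_le_mul_of_nonneg_left h3 (by linarith)
        _ = _ := by ring
    linarith

/-- This decouples the position of a hop, `a = (D / j) ^ (1 / 4)`, from its congestion `w`, so that
the two can be summed separately although the `N j` are arbitrary. -/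
lemma sq_mul_le_cube_add_cube {a w : ℝ} (ha : 0 ≤ a) (hw : 0 ≤ w) :
    a ^ 2 * w ≤ a ^ 3 + w ^ 3 := by
  rcases le_total w a with h | h
  · have : a ^ 2 * w ≤ a ^ 2 * a := by gcongr
    have : 0 ≤ w ^ 3 := by positivity
    nlinarith
  · have : a ^ 2 * w ≤ w ^ 2 * w := by gcongr
    have : 0 ≤ a ^ 3 := by positivity
    nlinarith

/-- The left side is at most `(2 + r) ^ 5`, hence polylogarithmic in `1 + ν` and dominated by a
linear function, which is what the constraint on the sum of the `N j` can control. -/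
lemma cube_le_of_le_log {r ν : ℝ} (hr : 0 ≤ r) (hν : 0 ≤ ν) (h : r ≤ 4 + Real.log (1 + ν)) :
    (Real.sqrt r * (2 + r)) ^ 3 ≤ 48480 * (1 + ν) := by
  set w := Real.sqrt r * (2 + r) with hw
  have hw0 : 0 ≤ w := by positivity
  have h1 : w ^ 2 ≤ (2 + r) ^ 3 := by
    rw [hw, mul_pow, Real.sq_sqrt hr]
    nlinarith [sq_nonneg (2 + r)]
  have h2 : w ^ 3 ≤ (2 + r) ^ 5 := by
    refine abs_le_of_sq_le_sq' ?_ (by positivity) |>.2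
    calc (w ^ 3) ^ 2 = (w ^ 2) ^ 3 := by ring
      _ ≤ ((2 + r) ^ 3) ^ 3 := by gcongr
      _ = (2 + r) ^ 9 := by ring
      _ ≤ (2 + r) ^ 10 := pow_le_pow_right₀ (by linarith) (by norm_num)
      _ = ((2 + r) ^ 5) ^ 2 := by ring
  set y := 6 + Real.log (1 + ν) with hy
  have hy0 : 0 ≤ y := by
    have := Real.log_nonneg (by linarith : (1 : ℝ) ≤ 1 + ν)
    linarith
  have h3 := Real.pow_div_factorial_le_exp y hy0 5
  have h4 : ((Nat.factorial 5 : ℕ) : ℝ) = 120 := by norm_num [Nat.factorial]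
  rw [h4, div_le_iff₀ (by norm_num), hy, Real.exp_add, Real.exp_log (by linarith)] at h3
  have h5 : Real.exp 6 ≤ 404 := by
    calc Real.exp 6 = Real.exp 1 ^ 6 := by rw [← Real.exp_nat_mul]; norm_num
      _ ≤ 2.7182818286 ^ 6 := by
          gcongr
          exact Real.exp_one_lt_d9.le
      _ ≤ 404 := by norm_num
  calc w ^ 3 ≤ (2 + r) ^ 5 := h2
    _ ≤ (6 + Real.log (1 + ν)) ^ 5 := pow_le_pow_left₀ (by linarith) (by linarith) 5
    _ ≤ Real.exp 6 * (1 + ν) * 120 := h3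
    _ ≤ 404 * (1 + ν) * 120 := by gcongr
    _ = _ := by ring

variable {n D b : ℕ}

lemma bounds_of_phase_length (hn : 2 ≤ n)
    (hT : (10 : ℝ) ^ 20 * (D * lg (n / D) + lg n ^ 2) ≤ 4 ^ b) :
    (10 : ℝ) ^ 20 * (D * lg (n / D)) ≤ 4 ^ b ∧ (10 : ℝ) ^ 10 * lg n ≤ 2 ^ b ∧
      Real.log n + 3 ≤ 4 * lg n ∧ (10 : ℝ) ^ 20 * D ≤ 4 ^ b := by
  have hl := one_le_lg ((n : ℝ) / D)
  have hL := one_le_lg (n : ℝ)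
  have hD0 : (0 : ℝ) ≤ D := Nat.cast_nonneg D
  have h0 : 0 ≤ (D : ℝ) * lg (n / D) := by positivity
  have h1 : (10 : ℝ) ^ 20 * (D * lg (n / D)) ≤ 4 ^ b := by nlinarith
  refine ⟨h1, ?_, ?_, le_trans ?_ h1⟩
  · refine abs_le_of_sq_le_sq' ?_ (by positivity) |>.2
    rw [sq (2 ^ b : ℝ), ← four_pow_eq]
    nlinarith
  · have := log_le_lg (by positivity : (0 : ℝ) < n)
    linarith
  · have : (D : ℝ) ≤ D * lg (n / D) := le_mul_of_one_le_right hD0 hl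
    linarith

lemma div_rate_le {k : ℝ} (hn : 2 ≤ n)
    (hT : (10 : ℝ) ^ 20 * (D * lg (n / D) + lg n ^ 2) ≤ 4 ^ b) (hk : k ≤ Real.log n + 3) :
    1 + k / rate b D ≤ 2 + k * D / 4 ^ b := by
  obtain ⟨-, h2, h3, -⟩ := bounds_of_phase_length hn hT
  have hL := one_le_lg (n : ℝ)
  have h4 : k / rate b D = k * D / 4 ^ b + k / 2 ^ b := by
    unfold rate
    rw [four_pow_eq]
    field_simp
  have h5 : k / 2 ^ b ≤ 1 := by
    rw [div_le_one (by positivity)]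
    nlinarith
  linarith

/-- With `β = log n / 4 ^ b` this is the requirement `β * g ≤ 1 / 2` of the drift argument. The term
`lg n ^ 2` in the phase length makes `geomRate` small compared with `2 ^ b`, since the rate is
capped at `2 ^ b`. -/
lemma waitingTime_le {N j : ℕ} (hn : 2 ≤ n) (hN : N ≤ n) (hD : 1 ≤ D)
    (hT : (10 : ℝ) ^ 20 * (D * lg (n / D) + lg n ^ 2) ≤ 4 ^ b) :
    2 * Real.log n * waitingTime b (j - 1) D (Real.log N + 3) ≤ 4 ^ b := by
  obtain ⟨h1, h2, h3, h4⟩ := bounds_of_phase_length hn hT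
  have hn' : (2 : ℝ) ≤ n := by exact_mod_cast hn
  have hD' : (1 : ℝ) ≤ D := by exact_mod_cast hD
  have hlogN : 0 ≤ Real.log (N : ℝ) := Real.log_natCast_nonneg N
  have hlogn : 0 ≤ Real.log (n : ℝ) := Real.log_natCast_nonneg n
  set k := Real.log (N : ℝ) + 3 with hk
  have hkn : k ≤ Real.log n + 3 := by
    rcases Nat.eq_zero_or_pos N with rfl | hN0
    · simpa [hk] using hlogn
    · have : (0 : ℝ) < N := by exact_mod_cast hN0
      have : (N : ℝ) ≤ n := by exact_mod_cast hN
      rw [hk]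
      gcongr
  have hdr := div_rate_le hn hT hkn
  have hlogL := log_le_lg (by linarith : (0 : ℝ) < n)
  set L := lg n with hL
  have hL1 : 1 ≤ L := one_le_lg _
  set t : ℝ := 2 ^ b with ht
  have ht0 : 0 < t := by positivity
  have hTt : (4 : ℝ) ^ b = t * t := four_pow_eq b
  have hk0 : 0 ≤ k := by linarith
  have hroot : geomRate b (j - 1) k ≤ 2 * t / 10 ^ 5 := by
    refine Real.sqrt_le_iff.2 ⟨by positivity, ?_⟩
    calc rate b (j - 1) * k ≤ t * (4 * L) :=
          mul_le_mul (rate_le_two_pow b _) (by linarith) hk0 ht0.le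
      _ ≤ (2 * t / 10 ^ 5) ^ 2 := by nlinarith
  have hg0 : 0 ≤ geomRate b (j - 1) k := Real.sqrt_nonneg _
  have hfac0 : 0 ≤ 1 + k / rate b D := by
    have := rate_pos b D
    positivity
  -- For `D ≤ √n`, `lg n` and `lg (n / D)` are comparable and the second factor of `waitingTime` is
  -- at most `3`. For larger `D` that factor is only `O(lg n)`, but then `4 ^ b` exceeds a multiple
  -- of `√n` and `2 ^ b` absorbs `lg n ^ 2`.
  rcases le_or_gt (D ^ 2) n with hDn | hDn
  · have hl : L ≤ 2 * lg (n / D) := by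
      have h5 : Real.logb 2 (n / D) ≤ lg (n / D) := le_max_left _ _
      rw [Real.logb_div (by positivity) (by positivity)] at h5
      have h6 : 2 * Real.logb 2 D ≤ Real.logb 2 n := by
        have : (D : ℝ) ^ 2 ≤ n := by exact_mod_cast hDn
        have h7 := Real.logb_le_logb_of_le one_lt_two (by positivity) this
        rwa [Real.logb_pow] at h7
      rw [hL, lg_eq_logb hn]
      linarith
    have h5 : k * D / 4 ^ b ≤ 1 := by
      rw [div_le_one (by positivity)]
      nlinarith
    calc 2 * Real.log n * waitingTime b (j - 1) D k
        = 2 * Real.log n * (2400 * geomRate b (j - 1) k * (1 + k / rate b D)) := rfl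
      _ ≤ 2 * L * (2400 * (2 * t / 10 ^ 5) * 3) := by
          gcongr
          linarith
      _ ≤ 4 ^ b := by rw [hTt]; nlinarith
  · have hDn' : (n : ℝ) ≤ D ^ 2 := by exact_mod_cast hDn.le
    have h5 : k * D / 4 ^ b ≤ k := by
      rw [div_le_iff₀ (by positivity)]
      have : (D : ℝ) ≤ 4 ^ b := by nlinarith
      gcongr
    have h6 : 28800 * L ^ 2 ≤ t := by
      refine le_of_pow_le_pow_left₀ (n := 4) (by norm_num) ht0.le ?_
      calc (28800 * L ^ 2) ^ 4 = (28800 : ℝ) ^ 4 * L ^ 8 := by ring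
        _ ≤ (28800 : ℝ) ^ 4 * (256 * 40320 * n) := by
            gcongr
            exact lg_pow_eight_le hn
        _ ≤ (28800 : ℝ) ^ 4 * (256 * 40320 * (D : ℝ) ^ 2) := by gcongr
        _ ≤ ((10 : ℝ) ^ 20 * D) ^ 2 := by
            rw [mul_pow, ← mul_assoc]
            gcongr
            norm_num
        _ ≤ (4 ^ b) ^ 2 := by gcongr
        _ = t ^ 4 := by rw [hTt]; ring
    calc 2 * Real.log n * waitingTime b (j - 1) D k
        = 2 * Real.log n * (2400 * geomRate b (j - 1) k * (1 + k / rate b D)) := rfl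
      _ ≤ 2 * L * (2400 * t * (6 * L)) := by
          gcongr
          · refine hroot.trans ?_
            linarith
          · linarith
      _ = 28800 * L ^ 2 * t := by ring
      _ ≤ t * t := by gcongr
      _ = 4 ^ b := hTt.symm

/-- Here `N * (D / n)` compares the competition at the hop with its average `n / D`. Measured in
units of `lg (n / D)`, `k` exceeds a constant by at most the logarithm of this excess. -/
lemma waitingTime_le_weight {N j : ℕ} (hn : 2 ≤ n) (hN : N ≤ n) (hD : 1 ≤ D) (hj : 1 ≤ j)
    (hT : (10 : ℝ) ^ 20 * (D * lg (n / D) + lg n ^ 2) ≤ 4 ^ b) :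
    waitingTime b (j - 1) D (Real.log N + 3) ≤ 2400 * Real.sqrt (4 ^ b * lg (n / D) / D) *
      (Real.sqrt (Real.sqrt D) ^ 3 * (1 / Real.sqrt (Real.sqrt j) ^ 3) +
        48480 * (1 + N * (D / n))) := by
  obtain ⟨h1, h2, h3, h4⟩ := bounds_of_phase_length hn hT
  have hn' : (2 : ℝ) ≤ n := by exact_mod_cast hn
  have hD' : (1 : ℝ) ≤ D := by exact_mod_cast hD
  have hj' : (1 : ℝ) ≤ j := by exact_mod_cast hj
  have hlogN : 0 ≤ Real.log (N : ℝ) := Real.log_natCast_nonneg N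
  have hlogn : 0 ≤ Real.log (n : ℝ) := Real.log_natCast_nonneg n
  set k := Real.log (N : ℝ) + 3 with hk
  have hkn : k ≤ Real.log n + 3 := by
    rcases Nat.eq_zero_or_pos N with rfl | hN0
    · simpa [hk] using hlogn
    · have : (0 : ℝ) < N := by exact_mod_cast hN0
      have : (N : ℝ) ≤ n := by exact_mod_cast hN
      rw [hk]
      gcongr
  have hk0 : 0 ≤ k := by linarith
  have hdr := div_rate_le hn hT hkn
  set l := lg ((n : ℝ) / D) with hl
  have hl1 : 1 ≤ l := one_le_lg _
  set ν := (N : ℝ) * (D / n) with hν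
  have hν0 : 0 ≤ ν := by positivity
  have hr : k / l ≤ 4 + Real.log (1 + ν) := by
    have h5 : 0 ≤ Real.log (1 + ν) := Real.log_nonneg (by linarith)
    rw [div_le_iff₀ (by linarith)]
    have h6 : Real.log N ≤ l + Real.log (1 + ν) := by
      rcases Nat.eq_zero_or_pos N with rfl | hN0
      · simp only [Nat.cast_zero, Real.log_zero]
        linarith
      · have hN1 : (0 : ℝ) < N := by exact_mod_cast hN0
        have h7 : (N : ℝ) = (n / D) * ν := by
          rw [hν]
          field_simp
        have h8 : 0 < ν := by positivity
        have h9 := log_le_lg (x := (n : ℝ) / D) (by positivity)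
        have h10 : Real.log ν ≤ Real.log (1 + ν) := by
          gcongr
          linarith
        calc Real.log N = Real.log (n / D) + Real.log ν := by
              conv_lhs => rw [h7]
              exact Real.log_mul (by positivity) h8.ne'
          _ ≤ _ := by linarith
    nlinarith
  set r := k / l with hrdef
  have hr0 : 0 ≤ r := by positivity
  have hcube := cube_le_of_le_log hr0 hν0 hr
  set x := Real.sqrt (Real.sqrt (D : ℝ)) with hx
  set y := Real.sqrt (Real.sqrt (j : ℝ)) with hy
  have hy0 : 0 < y := Real.sqrt_pos.2 (Real.sqrt_pos.2 (by linarith))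
  have hx0 : 0 ≤ x := Real.sqrt_nonneg _
  have hx2 : x ^ 2 = Real.sqrt D := Real.sq_sqrt (Real.sqrt_nonneg _)
  have hy2 : y ^ 2 = Real.sqrt j := Real.sq_sqrt (Real.sqrt_nonneg _)
  have hgeom : geomRate b (j - 1) k ≤ Real.sqrt (4 ^ b * l / D) * ((x / y) ^ 2 * Real.sqrt r) := by
    rw [div_pow, hx2, hy2, ← Real.sqrt_div (Nat.cast_nonneg D), ← Real.sqrt_mul (by positivity),
      ← Real.sqrt_mul (by positivity)]
    refine Real.sqrt_le_sqrt ?_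
    have h5 : rate b (j - 1) ≤ 4 ^ b / j := by
      unfold rate
      have h6 : (1 : ℝ) ≤ 2 ^ b := one_le_pow₀ one_le_two
      have h7 : (((j - 1 : ℕ) : ℝ)) = j - 1 := by push_cast [hj]; rfl
      rw [h7]
      gcongr
      linarith
    calc rate b (j - 1) * k ≤ 4 ^ b / j * k := by gcongr
      _ = 4 ^ b * l / D * (D / j * r) := by
          rw [hrdef]
          field_simp
  have hfac : 1 + k / rate b D ≤ 2 + r := by
    refine hdr.trans ?_
    have h5 : k * D / 4 ^ b ≤ k / l := by
      rw [div_le_div_iff₀ (by positivity) (by linarith)]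
      have : D * l ≤ 4 ^ b := by nlinarith
      calc k * D * l = k * (D * l) := by ring
        _ ≤ k * 4 ^ b := by gcongr
    linarith
  have hfac0 : 0 ≤ 1 + k / rate b D := by
    have := rate_pos b D
    positivity
  have hw0 : 0 ≤ Real.sqrt r * (2 + r) := by positivity
  have hsc := sq_mul_le_cube_add_cube (a := x / y) (by positivity) hw0
  calc waitingTime b (j - 1) D k = 2400 * geomRate b (j - 1) k * (1 + k / rate b D) := rfl
    _ ≤ 2400 * (Real.sqrt (4 ^ b * l / D) * ((x / y) ^ 2 * Real.sqrt r)) * (2 + r) := by gcongr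
    _ = 2400 * Real.sqrt (4 ^ b * l / D) * ((x / y) ^ 2 * (Real.sqrt r * (2 + r))) := by ring
    _ ≤ 2400 * Real.sqrt (4 ^ b * l / D) * ((x / y) ^ 3 + (Real.sqrt r * (2 + r)) ^ 3) := by gcongr
    _ ≤ 2400 * Real.sqrt (4 ^ b * l / D) * ((x / y) ^ 3 + 48480 * (1 + ν)) := by gcongr
    _ = _ := by rw [div_pow, mul_one_div]

/-- Both weights sum to `O(D)`, the second because the `N j` sum to at most `n`. The common factor
times `D` is `√(4 ^ b * D * lg (n / D))`, which is at most `4 ^ b / 10 ^ 10` by the choice of the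
phase. -/
lemma sum_waitingTime_le {d : ℕ} {N : ℕ → ℕ} (hn : 2 ≤ n) (hD : 1 ≤ D) (hdD : d ≤ D)
    (hN : ∑ j ∈ Finset.Icc 1 d, N j ≤ n)
    (hT : (10 : ℝ) ^ 20 * (D * lg (n / D) + lg n ^ 2) ≤ 4 ^ b) :
    ∑ j ∈ Finset.Icc 1 d, waitingTime b (j - 1) D (Real.log (N j) + 3) ≤ 4 ^ b / 2 := by
  obtain ⟨h1, -, -, -⟩ := bounds_of_phase_length hn hT
  have hn' : (2 : ℝ) ≤ n := by exact_mod_cast hn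
  have hD' : (1 : ℝ) ≤ D := by exact_mod_cast hD
  have hdD' : (d : ℝ) ≤ D := by exact_mod_cast hdD
  have hl1 := one_le_lg ((n : ℝ) / D)
  set l := lg ((n : ℝ) / D)
  set A := Real.sqrt (4 ^ b * l / D) with hA
  have hA0 : 0 ≤ A := Real.sqrt_nonneg _
  set x := Real.sqrt (Real.sqrt (D : ℝ)) with hx
  have hx0 : 0 ≤ x := Real.sqrt_nonneg _
  have hx4 : x ^ 4 = D := by
    rw [show (4 : ℕ) = 2 * 2 by norm_num, pow_mul, Real.sq_sqrt (Real.sqrt_nonneg _),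
      Real.sq_sqrt (by linarith)]
  have hsum1 : ∑ j ∈ Finset.Icc 1 d, 1 / Real.sqrt (Real.sqrt j) ^ 3 ≤ 4 * x :=
    (sum_inv_fourthRoot_cubed_le d).trans (mul_le_mul_of_nonneg_left
      (Real.sqrt_le_sqrt (Real.sqrt_le_sqrt hdD')) (by norm_num))
  have hsum2 : ∑ j ∈ Finset.Icc 1 d, (1 + (N j : ℝ) * (D / n)) ≤ 2 * D := by
    rw [Finset.sum_add_distrib, ← Finset.sum_mul]
    have h2 : ∑ j ∈ Finset.Icc 1 d, (N j : ℝ) ≤ n := by exact_mod_cast hN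
    have h3 : (∑ j ∈ Finset.Icc 1 d, (N j : ℝ)) * (D / n) ≤ n * (D / n) := by gcongr
    have h4 : (n : ℝ) * (D / n) = D := by field_simp
    simp only [Finset.sum_const, Nat.card_Icc, Nat.add_sub_cancel, nsmul_eq_mul, mul_one]
    linarith
  have hAD : A * D ≤ 4 ^ b / 10 ^ 10 := by
    refine abs_le_of_sq_le_sq' ?_ (by positivity) |>.2
    rw [mul_pow, hA, Real.sq_sqrt (by positivity)]
    have h2 : (4 : ℝ) ^ b * l / D * D ^ 2 = 4 ^ b * (D * l) := by field_simp
    rw [h2, div_pow, le_div_iff₀ (by positivity)]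
    calc 4 ^ b * (D * l) * ((10 : ℝ) ^ 10) ^ 2 = 4 ^ b * (10 ^ 20 * (D * l)) := by ring
      _ ≤ 4 ^ b * 4 ^ b := by gcongr
      _ = (4 ^ b) ^ 2 := by ring
  calc ∑ j ∈ Finset.Icc 1 d, waitingTime b (j - 1) D (Real.log (N j) + 3)
      ≤ ∑ j ∈ Finset.Icc 1 d, 2400 * A * (x ^ 3 * (1 / Real.sqrt (Real.sqrt j) ^ 3) +
        48480 * (1 + N j * (D / n))) := Finset.sum_le_sum fun j hj =>
          waitingTime_le_weight hn ((Finset.single_le_sum (fun i _ => Nat.zero_le (N i)) hj).trans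
            hN) hD (Finset.mem_Icc.1 hj).1 hT
    _ = 2400 * A * (x ^ 3 * (∑ j ∈ Finset.Icc 1 d, 1 / Real.sqrt (Real.sqrt j) ^ 3) +
        48480 * ∑ j ∈ Finset.Icc 1 d, (1 + (N j : ℝ) * (D / n))) := by
          rw [← Finset.mul_sum, Finset.sum_add_distrib, ← Finset.mul_sum, ← Finset.mul_sum]
    _ ≤ 2400 * A * (x ^ 3 * (4 * x) + 48480 * (2 * D)) := by gcongr
    _ = 2400 * (4 + 96960) * (A * D) := by
          rw [← hx4]
          ring
    _ ≤ 2400 * (4 + 96960) * (4 ^ b / 10 ^ 10) := by gcongr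
    _ ≤ 4 ^ b / 2 := by
          have : (0 : ℝ) < 4 ^ b := by positivity
          linarith

end Estimates

/-! ### Choice of the phase and union bound -/

section Completion

lemma measure_not_completedWithin_le {n D b : ℕ} (hn : 2 ≤ n) {G : Digraph (Fin n)} {s : Fin n}
    (m : BitString) {δ : Fin n → ℕ} (hδ : IsHopDistance G s δ) (hδD : ∀ v, δ v ≤ D) {τ : ℝ}
    (hT : (10 : ℝ) ^ 20 * (D * lg (n / D) + lg n ^ 2) ≤ 4 ^ b) (hτ : 4 ^ (b + 1) ≤ τ) :
    randomness backoffProtocol (Fin n) {ω | ¬ CompletedWithin backoffProtocol G s m ω τ} ≤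
      ENNReal.ofReal ((n : ℝ)⁻¹) := by
  obtain ⟨h1, h2, h3, h4⟩ := bounds_of_phase_length hn hT
  have hn' : (2 : ℝ) ≤ n := by exact_mod_cast hn
  have hL1 := one_le_lg (n : ℝ)
  have hlog0 : 0 < Real.log n := Real.log_pos (by linarith)
  have hVb : Real.log (Fintype.card (Fin n)) + 3 ≤ 2 ^ b := by
    rw [Fintype.card_fin]
    linarith
  have hb : 2 ≤ b := by
    by_contra! hb
    have : (2 : ℝ) ^ b ≤ 2 ^ 1 := pow_le_pow_right₀ one_le_two (by omega)
    linarith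
  have h4b : (1 : ℝ) ≤ 4 ^ b := one_le_pow₀ (by norm_num)
  have hDlt : D < 4 ^ b := by
    have h5 : (D : ℝ) < 4 ^ b := by
      rcases Nat.eq_zero_or_pos D with rfl | hD
      · simp
      · have : (1 : ℝ) ≤ D := by exact_mod_cast hD
        linarith
    exact_mod_cast h5
  have hsub : {ω : Fin n → ℕ → Sample | ¬ CompletedWithin backoffProtocol G s m ω τ} ⊆
      ⋃ v : Fin n, {ω | v ∉ phaseSet G s δ b (3 * 4 ^ b) ω} := by
    intro ω hω
    by_contra hcon
    simp only [Set.mem_iUnion, Set.mem_ofPred_eq, not_exists, not_not] at hcon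
    exact hω (completedWithin_of_phaseSet hδ (by omega)
      (fun v => (hδD v).trans_lt hDlt) τ hτ hcon)
  have hone : ∀ v : Fin n,
      (Measure.pi fun _ : Fin n => Measure.infinitePi fun _ : ℕ => (volume : Measure Sample))
        {ω | v ∉ phaseSet G s δ b (3 * 4 ^ b) ω} ≤ ENNReal.ofReal ((n : ℝ)⁻¹ ^ 2) := by
    intro v
    by_cases hvs : v = s
    · subst hvs
      simp [source_mem_phaseSet]
    have hD1 : 1 ≤ D := (Nat.one_le_iff_ne_zero.2
      fun h => hvs ((hδ.eq_source v).1 h)).trans (hδD v)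
    obtain ⟨N, hN, hP⟩ := measure_notMem_phaseSet_le hδ hδD hDlt.le hb hVb hvs
    rw [Fintype.card_fin] at hN
    have hT0 : (0 : ℝ) < 4 ^ b := by positivity
    have hsum := sum_waitingTime_le hn hD1 (hδD v) hN hT
    -- With this `β`, the `3 * 4 ^ b` steps contribute `-3 * log n` to the exponent and the waiting
    -- times at most `log n`, leaving `n⁻²` for each node.
    refine (hP (Real.log n / 4 ^ b) (by positivity) ?_ (fun j hj => ?_) (3 * 4 ^ b)).trans ?_
    · rw [div_le_one hT0]
      have h5 := log_le_lg (by linarith : (0 : ℝ) < n)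
      have h6 : (2 : ℝ) ^ b ≤ 4 ^ b := by gcongr; norm_num
      linarith
    · have h5 := waitingTime_le (j := j) hn
        ((Finset.single_le_sum (fun i _ => Nat.zero_le (N i)) hj).trans hN) hD1 hT
      rw [div_mul_eq_mul_div, div_le_iff₀ hT0]
      linarith
    · refine ENNReal.ofReal_le_ofReal ?_
      have h5 : (n : ℝ)⁻¹ ^ 2 = Real.exp (-(2 * Real.log n)) := by
        rw [← Real.exp_log (by positivity : (0 : ℝ) < (n : ℝ)⁻¹), ← Real.exp_nat_mul, Real.log_inv]
        push_cast
        ring_nf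
      rw [h5]
      refine Real.exp_le_exp.2 ?_
      have h6 : Real.log n / 4 ^ b * ((3 * 4 ^ b : ℕ) : ℝ) = 3 * Real.log n := by
        push_cast
        field_simp
      have h7 : 2 * (Real.log n / 4 ^ b) * ∑ j ∈ Finset.Icc 1 (δ v),
          waitingTime b (j - 1) D (Real.log (N j) + 3) ≤ Real.log n := by
        calc _ ≤ 2 * (Real.log n / 4 ^ b) * (4 ^ b / 2) := by gcongr
          _ = Real.log n := by field_simp
      rw [h6]
      linarith
  calc randomness backoffProtocol (Fin n) {ω | ¬ CompletedWithin backoffProtocol G s m ω τ}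
      ≤ (Measure.pi fun _ : Fin n => Measure.infinitePi fun _ : ℕ => (volume : Measure Sample))
        (⋃ v : Fin n, {ω | v ∉ phaseSet G s δ b (3 * 4 ^ b) ω}) := measure_mono hsub
    _ ≤ ∑ v : Fin n, ENNReal.ofReal ((n : ℝ)⁻¹ ^ 2) :=
        (measure_iUnion_fintype_le _ _).trans (Finset.sum_le_sum fun v _ => hone v)
    _ = ENNReal.ofReal ((n : ℝ)⁻¹) := by
        rw [Finset.sum_const, Finset.card_univ, Fintype.card_fin, nsmul_eq_mul,
          ← ENNReal.ofReal_natCast, ← ENNReal.ofReal_mul (Nat.cast_nonneg n)]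
        congr 1
        field_simp

/-- For the least suitable `b`, rounding up to a power of `4` costs one factor `4`, and waiting for
the end of the phase another. -/
lemma exists_phase (B : ℝ) (hB : 1 ≤ B) : ∃ b : ℕ, B ≤ 4 ^ b ∧ (4 : ℝ) ^ (b + 1) ≤ 16 * B := by
  classical
  have hex : ∃ b : ℕ, B ≤ 4 ^ b := (pow_unbounded_of_one_lt B (by norm_num)).imp fun _ => le_of_lt
  refine ⟨Nat.find hex, Nat.find_spec hex, ?_⟩
  rcases hb : Nat.find hex with _ | b
  · norm_num
    linarith
  · have := not_le.1 (Nat.find_min hex (m := b) (by omega))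
    rw [pow_succ, pow_succ]
    linarith

lemma le_timeBound (n D : ℕ) : D * lg (n / D) + lg n ^ 2 ≤ timeBound n D := by
  unfold timeBound
  have h1 := one_le_lg ((n : ℝ) / D)
  have : (D : ℝ) * lg (n / D) ≤ D * lg (n / D) * lg (lg (lg (n / D))) :=
    le_mul_of_one_le_right (by positivity) (one_le_lg _)
  linarith

end Completion

end RadioNetwork

open RadioNetwork in
theorem mainTheorem2 :
    ∃ (A : BlindProtocol) (K c : ℝ) (n₀ : ℕ), 0 < K ∧ 0 < c ∧
      ∀ n : ℕ, n₀ ≤ n → ∀ (G : Digraph (Fin n)) (s : Fin n) (m : BitString) (D : ℕ),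
        eccentricity G s ≤ D →
          randomness A (Fin n) {ω | ¬ CompletedWithin A G s m ω (K * timeBound n D)} ≤
            ENNReal.ofReal ((n : ℝ) ^ (-c)) := by
  -- The factor `10 ^ 20` is the phase length required by the estimates, and `16` comes from
  -- `exists_phase`.
  refine ⟨backoffProtocol, 16 * 10 ^ 20, 1, 2, by norm_num, one_pos, fun n hn G s m D hD => ?_⟩
  obtain ⟨δ, hδ, hδD⟩ := exists_isHopDistance G s D hD
  have hl := one_le_lg ((n : ℝ) / D)
  have hL := one_le_lg (n : ℝ)
  have hB : 1 ≤ (10 : ℝ) ^ 20 * (D * lg (n / D) + lg n ^ 2) := by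
    have : (0 : ℝ) ≤ D * lg (n / D) := by positivity
    nlinarith
  obtain ⟨b, hb1, hb2⟩ := exists_phase _ hB
  rw [Real.rpow_neg_one]
  refine measure_not_completedWithin_le hn m hδ hδD hb1 (hb2.trans ?_)
  rw [← mul_assoc]
  exact mul_le_mul_of_nonneg_left (le_timeBound n D) (by norm_num)
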